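/- All Hilbert spaces are finite-dimensional and $\log$ is the binary logarithm. For a nonnegative operator $\rho_{AB}$ on $\mathcal H_A\otimes\mathcal H_B$ the conditional min-entropy is $$H_{\min}(A|B)_\rho=-\log\min_{\sigma_B}\min\{\lambda:\rho_{AB}\le\lambda\,\mathrm{id}_A\otimes\sigma_B\},$$ where $\sigma_B$ ranges over the density operators on $\mathcal H_B$ (and $H_{\min}(A|B)_\rho=+\infty$ if $\rho_{AB}=0$). For $\eta\ge 0$ the smooth min-entropy is $H_{\min}^{\eta}(A|B)_\rho=\sup_{\bar\rho}H_{\min}(A|B)_{\bar\rho}$, the supremum being over all nonnegative operators $\bar\rho_{AB}$ with $\mathrm{tr}\,\bar\rho_{AB}\le 1$ and $\|\bar\rho_{AB}-\rho_{AB}\|\le\eta$, where $\|M\|=\mathrm{tr}\sqrt{M^\dagger M}$. The smooth min-entropy rate is $R_{\min}^\eta(A|B)_\rho=H_{\min}^\eta(A|B)_\rho/\log\dim\mathcal H_A$. Let $P_{\mathcal S}$ be a probability distribution on subsets $\mathcal S\subseteq[n]=\{1,\dots,n\}$, supported on subsets of one fixed size $|\mathcal S|=r\ge 1$. Let $\xi\in[0,1]$,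 $\delta\ge 0$ and $\varepsilon$ be real numbers. For $M\in\mathbb N$ and $\beta\in[0,1]^{M\times n}$ let $\mathcal B(\beta,\mathcal S,\xi)$ be the set of $\alpha\in[M]$ with $\frac1{|\mathcal S|}\sum_{i\in\mathcal S}\beta^\alpha_i\le\frac1n\sum_{i=1}^n\beta^\alpha_i-\xi$. Then $P_{\mathcal S}$ is an $(n,\xi,\delta,\varepsilon)$-parallel sampler if for every $M\in\mathbb N$, every probability distribution $\omega$ on $[M]$ and every $\beta\in[0,1]^{M\times n}$, $$\Pr_{\mathcal S}\left[\omega(\mathcal B(\beta,\mathcal S,\xi))\ge\delta\right]\le\varepsilon .$$ **Theorem.** Let $\mathcal X$ be a finite alphabet with $|\mathcal X|\ge 2$, and let $\rho_{X^nE}=\sum_{x\in\mathcal X^n}|x\rangle\langle x|\otimes\rho_E^x$ be a density operator that is classical on $X^n=(X_1,\dots,X_n)$. Let $\mathcal S$ be a random subset of $[n]$ of size $|\mathcal S|=r\ge1$, independent of $X^nE$, whose distribution $P_{\mathcal S}$ is an $(n,\xi,\delta,\varepsilon)$-parallel sampler, and assume $$\kappa=\frac{n}{|\mathcal S|\log|\mathcal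 X|}\le 0.15 .$$ Write $X_{\mathcal S}$ for the substring of $X^n$ at the positions in $\mathcal S$, so that the joint state of $X_{\mathcal S}$, $\mathcal S$ and $E$ is $\sum_sP_{\mathcal S}(s)\sum_x|x_s\rangle\langle x_s|\otimes|s\rangle\langle s|\otimes\rho_E^x$. Then for all $\theta>0$ and $\tau\ge 0$, $$R_{\min}^{2\sqrt\delta+\varepsilon+2\theta+\tau}(X_{\mathcal S}|\mathcal S E)_\rho\ \ge\ R_{\min}^{\tau}(X^n|E)_\rho-\Delta,\qquad \Delta=\xi+\frac{2\log(1/\theta)}{n\log|\mathcal X|}+2\kappa\log\frac1\kappa ,$$ as an inequality between elements of $(-\infty,+\infty]$. -/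

import Mathlib

/-!
Systems are finite-dimensional Hilbert spaces `ℂ^A` with `A` a finite index set (a fixed orthonormal
basis); an operator on `A ⊗ B` is a complex matrix indexed by `A × B`.  All logarithms are binary.
Entropies take values in `EReal`, since the min-entropy of the zero operator is `+∞`.
-/

open scoped Kronecker ComplexOrder

namespace EntropySampling

noncomputable section

/-- The trace norm (`L₁`-norm) `‖M‖ = tr √(M† M)`. -/
def traceNorm {I : Type*} [Fintype I] [DecidableEq I] (M : Matrix I I ℂ) : ℝ :=
  (cfc Real.sqrt (M.conjTranspose * M)).trace.re

/-- A density operator: nonnegative with trace one. -/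
def IsState {I : Type*} [Fintype I] (ρ : Matrix I I ℂ) : Prop :=
  ρ.PosSemidef ∧ ρ.trace = 1

/-- A subnormalised state: nonnegative with trace at most one. -/
def IsSubnormalizedState {I : Type*} [Fintype I] (ρ : Matrix I I ℂ) : Prop :=
  ρ.PosSemidef ∧ ρ.trace.re ≤ 1

/-- `ρ` on `A ⊗ E` is classical on `A`: it has the form `∑ a, |a⟩⟨a| ⊗ ρᵃ`. -/
def IsClassicalOn {A E : Type*} [Fintype A] [DecidableEq A]
    (ρ : Matrix (A × E) (A × E) ℂ) : Prop :=
  ∃ block : A → Matrix E E ℂ, ρ = ∑ a, Matrix.single a a (1 : ℂ) ⊗ₖ block a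

/-- The entropy of `A` given `B` of `ρ` relative to the operator `σ` on `B`:
`- log min {t : ρ ≤ t • (id ⊗ σ)}`, written as the supremum of `- log t` over the admissible `t > 0`
(so that it is `+∞` for `ρ = 0`, and `-∞` if no `t` is admissible). -/
def relMinEntropy {A B : Type*} [DecidableEq A]
    (ρ : Matrix (A × B) (A × B) ℂ) (σ : Matrix B B ℂ) : EReal :=
  ⨆ (t : ℝ) (_ : 0 < t ∧ (t • ((1 : Matrix A A ℂ) ⊗ₖ σ) - ρ).PosSemidef),
    ((-Real.logb 2 t : ℝ) : EReal)

/-- The conditional min-entropy of `A` given `B`: supremum over all density operators `σ` on `B`. -/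
def minEntropy {A B : Type*} [DecidableEq A] [Fintype B]
    (ρ : Matrix (A × B) (A × B) ℂ) : EReal :=
  ⨆ (σ : Matrix B B ℂ) (_ : IsState σ), relMinEntropy ρ σ

/-- The `η`-smooth min-entropy of `A` given `B`: supremum over all subnormalised states at trace-norm
distance at most `η` from `ρ`. -/
def smoothMinEntropy {A B : Type*} [Fintype A] [DecidableEq A] [Fintype B] [DecidableEq B]
    (η : ℝ) (ρ : Matrix (A × B) (A × B) ℂ) : EReal :=
  ⨆ (ρ' : Matrix (A × B) (A × B) ℂ) (_ : IsSubnormalizedState ρ' ∧ traceNorm (ρ' - ρ) ≤ η),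
    minEntropy ρ'

/-- The `η`-smooth min-entropy rate: the smooth min-entropy divided by `H₀(A) = log |A|`. -/
def smoothMinEntropyRate {A B : Type*} [Fintype A] [DecidableEq A] [Fintype B] [DecidableEq B]
    (η : ℝ) (ρ : Matrix (A × B) (A × B) ℂ) : EReal :=
  smoothMinEntropy η ρ / ((Real.logb 2 (Fintype.card A) : ℝ) : EReal)

/-- The subsets of `[n]` of size `r`. -/
abbrev Sample (n r : ℕ) : Type := {s : Finset (Fin n) // s.card = r}

/-- The set of rows `α` of `β` whose average over `s` is at most the average over `[n]` minus `ξ`. -/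
def badRows {M n : ℕ} (β : Fin M → Fin n → ℝ) (s : Finset (Fin n)) (ξ : ℝ) : Set (Fin M) :=
  {α | (1 / (s.card : ℝ)) * ∑ i ∈ s, β α i ≤ (1 / (n : ℝ)) * ∑ i, β α i - ξ}

open Classical in
/-- `P`, a probability distribution on the subsets of `[n]` of size `r`, is an
`(M, n, ξ, δ, ε)`-parallel sampler. -/
def IsParallelSamplerOfSize (M : ℕ) {n r : ℕ} (ξ δ ε : ℝ) (P : Sample n r → ℝ) : Prop :=
  P ∈ stdSimplex ℝ (Sample n r) ∧
    ∀ ω ∈ stdSimplex ℝ (Fin M), ∀ β : Fin M → Fin n → ℝ, (∀ α i, β α i ∈ Set.Icc (0 : ℝ) 1) →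
      (∑ s with δ ≤ (∑ α with α ∈ badRows β s.1 ξ, ω α), P s) ≤ ε

/-- An `(n, ξ, δ, ε)`-parallel sampler. -/
def IsParallelSampler {n r : ℕ} (ξ δ ε : ℝ) (P : Sample n r → ℝ) : Prop :=
  ∀ M : ℕ, IsParallelSamplerOfSize M ξ δ ε P

/-- The substring `x_s` of `x`: the entries at the positions in `s`, in increasing order. -/
def substring {n r : ℕ} {X : Type*} (x : Fin n → X) (s : Sample n r) : Fin r → X :=
  fun i => x (s.1.orderEmbOfFin s.2 i)

/-- The unnormalised conditional state `ρˣ` on `E` of an operator on `A ⊗ E`. -/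
def blockAt {A E : Type*} (ρ : Matrix (A × E) (A × E) ℂ) (a : A) : Matrix E E ℂ :=
  Matrix.of fun e e' => ρ (a, e) (a, e')

/-- The state of `X_S`, `S` and `E`, when `S` has distribution `P` and is independent of `Xⁿ E`,
where `Xⁿ` is classical:
`∑ s, P s ∑ x, |x_s⟩⟨x_s| ⊗ |s⟩⟨s| ⊗ ρˣ`, as an operator on `X_S ⊗ (S ⊗ E)`. -/
def sampledState {n r : ℕ} {X E : Type*} [Fintype X] [DecidableEq X]
    (P : Sample n r → ℝ) (ρ : Matrix ((Fin n → X) × E) ((Fin n → X) × E) ℂ) :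
    Matrix ((Fin r → X) × (Sample n r × E)) ((Fin r → X) × (Sample n r × E)) ℂ :=
  ∑ s, P s • ∑ x, Matrix.single (substring x s) (substring x s) (1 : ℂ) ⊗ₖ
    (Matrix.single s s (1 : ℂ) ⊗ₖ blockAt ρ x)

end

end EntropySampling

namespace EntropySampling

open Matrix
open scoped MatrixOrder

/-! ### Trace norm and its dual description by Hermitian contractions -/

section Trace

variable {I : Type*} [Fintype I]

/-! Classically, one would assign to each string a profile recording how unpredictable each
coordinate is given the earlier ones. A parallel sampler then guarantees that the sampled
coordinates carry nearly their share of the total. The quantum version replaces the sets of strings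
with a given profile by operators on `E`.

Let `ρ'` nearly attain the smooth entropy, with `ρ' ≤ t • (1 ⊗ σ)`; only its diagonal blocks `R x`
matter. After conjugation by an inverse root of `σ`, coordinates are peeled off from the last one.
For a fixed prefix, the eigenvalues of the sum over the last symbol are sorted into `m` bins of
ratio `q = |X|^(1/m)`. In bin `j` the last symbol has guessing weight at most `q^(-j)`, while the
operator bound on the prefix grows by at most `q^(j+1)`. Iterating (`exists_splitting`) gives
operators `T α x`, indexed by profiles `α`, which sum to `1` and whose cross terms vanish after
summation over `x`. A marginal on `s` is damped by `∏ q^(-α i)` over `s`, and the part with profile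
`α` is at most `t ∏ q^(α i + 1) • σ`.

The sampler is applied to the rows `α i / m`, weighted by the traces of the parts. For a good
sample, discarding the bad profiles costs `2√δ` by a gentle-measurement estimate
(`sum_trace_mul_conj_sub_le`); the other samples are replaced by zero and cost `ε`. Recombining the
good profiles costs a factor `m^n` by pinching, and normalising the sum of their reference operators
costs another `m^n` (`marginal_le`, `exists_smoothed_sampledState`).

The rate loss is thus `ξ`, plus `1/m` for the bin width, plus `2κ log m` for the two factors; taking
`m = ⌊1/(2κ)⌋` bounds the last two by `2κ log(1/κ)` (`exists_bin_count`). For `θ ≤ 1` the terms in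
`θ` only weaken the claim, and for `θ > 1` the zero operator is an admissible smoothing. -/

theorem trace_mul_re_nonneg {A B : Matrix I I ℂ} (hA : 0 ≤ A) (hB : 0 ≤ B) :
    0 ≤ (A * B).trace.re := by
  classical
  obtain ⟨C, rfl⟩ := CStarAlgebra.nonneg_iff_eq_star_mul_self.1 hA
  have h := (nonneg_iff_posSemidef.1 hB).mul_mul_conjTranspose_same C
  have h2 := h.trace_nonneg
  rw [star_eq_conjTranspose, Matrix.mul_assoc, Matrix.trace_mul_comm]
  exact (Complex.le_def.1 h2).1

theorem trace_re_nonneg {A : Matrix I I ℂ} (hA : 0 ≤ A) : 0 ≤ A.trace.re :=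
  (Complex.le_def.1 (nonneg_iff_posSemidef.1 hA).trace_nonneg).1

theorem conj_mono {J : Type*} [Fintype J] {A B : Matrix I I ℂ} (h : A ≤ B) (C : Matrix J I ℂ) :
    C * A * Cᴴ ≤ C * B * Cᴴ := by
  rw [le_iff] at h ⊢
  have := h.mul_mul_conjTranspose_same C
  rwa [Matrix.mul_sub, Matrix.sub_mul] at this

theorem conj_nonneg {J : Type*} [Fintype J] {A : Matrix I I ℂ} (h : 0 ≤ A) (C : Matrix J I ℂ) :
    0 ≤ C * A * Cᴴ := by
  simpa using conj_mono h C

variable [DecidableEq I]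

/-- Spectral decomposition `M = U diag(d) U†` in matrix form. -/
theorem exists_spectral {M : Matrix I I ℂ} (hM : M.IsHermitian) :
    ∃ (U : Matrix I I ℂ) (d : I → ℝ), U * Uᴴ = 1 ∧ Uᴴ * U = 1 ∧
      M = U * diagonal (fun i => (d i : ℂ)) * Uᴴ ∧
      ∀ f : ℝ → ℝ, cfc f M = U * diagonal (fun i => ((f (d i) : ℝ) : ℂ)) * Uᴴ := by
  refine ⟨hM.eigenvectorUnitary, hM.eigenvalues, ?_, ?_, ?_, ?_⟩
  · exact Unitary.coe_mul_star_self _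
  · exact Unitary.coe_star_mul_self _
  · conv_lhs => rw [hM.spectral_theorem]
    rfl
  · intro f
    rw [hM.cfc_eq f]
    rfl

theorem trace_unitary_diagonal {U : Matrix I I ℂ} (hU : Uᴴ * U = 1) (d : I → ℝ) :
    (U * diagonal (fun i => (d i : ℂ)) * Uᴴ).trace.re = ∑ i, d i := by
  rw [trace_mul_cycle, hU, Matrix.one_mul, trace_diagonal]
  simp

theorem unitary_diagonal_nonneg (U : Matrix I I ℂ) {d : I → ℝ} (hd : ∀ i, 0 ≤ d i) :
    0 ≤ U * diagonal (fun i => (d i : ℂ)) * Uᴴ := by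
  apply conj_nonneg
  rw [nonneg_iff_posSemidef]
  exact PosSemidef.diagonal fun i => by simpa using hd i

theorem unitary_diagonal_mul {U : Matrix I I ℂ} (hU : Uᴴ * U = 1) (d e : I → ℝ) :
    (U * diagonal (fun i => (d i : ℂ)) * Uᴴ) * (U * diagonal (fun i => (e i : ℂ)) * Uᴴ) =
      U * diagonal (fun i => ((d i * e i : ℝ) : ℂ)) * Uᴴ := by
  calc _ = U * diagonal (fun i => (d i : ℂ)) * (Uᴴ * U) * diagonal (fun i => (e i : ℂ)) * Uᴴ := by
        simp only [Matrix.mul_assoc]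
    _ = _ := by
        rw [hU, Matrix.mul_one, Matrix.mul_assoc U, diagonal_mul_diagonal]
        simp

theorem unitary_diagonal_mono (U : Matrix I I ℂ) {d e : I → ℝ} (h : ∀ i, d i ≤ e i) :
    U * diagonal (fun i => (d i : ℂ)) * Uᴴ ≤ U * diagonal (fun i => (e i : ℂ)) * Uᴴ := by
  apply conj_mono
  rw [le_iff, diagonal_sub]
  exact PosSemidef.diagonal fun i => by simpa using h i

theorem traceNorm_of_isHermitian {M : Matrix I I ℂ} (hM : M.IsHermitian) :
    traceNorm M = (cfc (fun x : ℝ => |x|) M).trace.re := by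
  have h1 : Mᴴ * M = cfc (fun x : ℝ => x ^ 2) M := by
    rw [cfc_pow_id (R := ℝ) M 2, hM.eq, sq]
  rw [traceNorm, h1, ← cfc_comp (hg := by fun_prop) (hf := by fun_prop)]
  congr 3
  ext x
  exact Real.sqrt_sq_eq_abs x

/-- The trace norm of a Hermitian matrix dominates its pairing with any Hermitian contraction. -/
theorem trace_mul_le_traceNorm {M K : Matrix I I ℂ} (hM : M.IsHermitian) (h1 : K ≤ 1)
    (h2 : -1 ≤ K) : (K * M).trace.re ≤ traceNorm M := by
  rw [traceNorm_of_isHermitian hM]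
  obtain ⟨U, d, hU, hU', hMd, hf⟩ := exists_spectral hM
  have hsplit : M = cfc (fun x : ℝ => max x 0) M - cfc (fun x : ℝ => max (-x) 0) M := by
    rw [hf, hf]
    conv_lhs => rw [hMd]
    rw [← Matrix.sub_mul, ← Matrix.mul_sub, diagonal_sub]
    congr 3
    ext i
    rcases le_total (d i) 0 with h | h <;> simp [h]
  have habs : (cfc (fun x : ℝ => |x|) M) =
      cfc (fun x : ℝ => max x 0) M + cfc (fun x : ℝ => max (-x) 0) M := by
    rw [hf, hf, hf, ← Matrix.add_mul, ← Matrix.mul_add, diagonal_add]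
    congr 3
    ext i
    rcases le_total (d i) 0 with h | h <;> simp [h, abs_of_nonpos, abs_of_nonneg]
  have hp : 0 ≤ cfc (fun x : ℝ => max x 0) M := by
    rw [hf]; exact unitary_diagonal_nonneg U fun i => le_max_right _ _
  have hn : 0 ≤ cfc (fun x : ℝ => max (-x) 0) M := by
    rw [hf]; exact unitary_diagonal_nonneg U fun i => le_max_right _ _
  have e1 := trace_mul_re_nonneg (sub_nonneg.2 h1) hp
  have e2 := trace_mul_re_nonneg (sub_nonneg.2 h2) hn
  rw [habs]
  conv_lhs => rw [hsplit]
  rw [sub_neg_eq_add] at e2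
  simp only [Matrix.mul_sub, Matrix.sub_mul, Matrix.add_mul, trace_sub, trace_add, Complex.sub_re,
    Complex.add_re, Matrix.one_mul] at e1 e2 ⊢
  linarith

/-- The trace norm of a Hermitian matrix is bounded as soon as all pairings with Hermitian
contractions are. -/
theorem traceNorm_le_of_forall {M : Matrix I I ℂ} (hM : M.IsHermitian) {c : ℝ}
    (h : ∀ K : Matrix I I ℂ, K ≤ 1 → -1 ≤ K → (K * M).trace.re ≤ c) : traceNorm M ≤ c := by
  rw [traceNorm_of_isHermitian hM]
  obtain ⟨U, d, hU, hU', hMd, hf⟩ := exists_spectral hM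
  have hone : ∀ a : ℝ, U * diagonal (fun _ : I => ((a : ℝ) : ℂ)) * Uᴴ = (a : ℂ) • 1 := by
    intro a
    rw [← smul_one_eq_diagonal, Matrix.mul_smul, Matrix.smul_mul, Matrix.mul_one, hU]
  have hb : ∀ x : ℝ, (if 0 ≤ x then (1 : ℝ) else -1) ≤ 1 ∧ -1 ≤ (if 0 ≤ x then (1 : ℝ) else -1) := by
    intro x; split_ifs <;> norm_num
  -- The optimal contraction is the sign of `M`; the value at eigenvalue `0` is immaterial.
  have key := h (U * diagonal (fun i => (((if 0 ≤ d i then 1 else -1 : ℝ)) : ℂ)) * Uᴴ) ?_ ?_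
  · rw [hMd, unitary_diagonal_mul hU', trace_unitary_diagonal hU'] at key
    rw [hf, trace_unitary_diagonal hU']
    refine le_trans (le_of_eq (Finset.sum_congr rfl fun i _ => ?_)) key
    split_ifs with h0
    · simp [abs_of_nonneg h0]
    · simp [abs_of_neg (not_le.1 h0)]
  · have := unitary_diagonal_mono U fun i => (hb (d i)).1
    rw [hone] at this
    simpa using this
  · have := unitary_diagonal_mono U fun i => (hb (d i)).2
    rw [hone] at this
    simpa using this

end Trace

/-! ### Splitting a family of blocks according to entropy profiles -/

section Splitting

variable {E : Type*} [Fintype E]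

theorem smul_mono_right {a : ℝ} (ha : 0 ≤ a) {A B : Matrix E E ℂ} (h : A ≤ B) : a • A ≤ a • B :=
  smul_le_smul_of_nonneg_left h ha

theorem smul_mono_left {a b : ℝ} (h : a ≤ b) {A : Matrix E E ℂ} (hA : 0 ≤ A) : a • A ≤ b • A :=
  smul_le_smul_of_nonneg_right h hA

/-- Bin `0` has no lower end, so arbitrarily small eigenvalues need no separate treatment: there the
trivial damping factor `q ^ 0 = 1` suffices. -/
theorem exists_bin {m : ℕ} (hm : 0 < m) (q c d : ℝ) (hd : d ≤ c * q ^ m) :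
    ∃ j : Fin m, d ≤ c * q ^ ((j : ℕ) + 1) ∧ ((j : ℕ) = 0 ∨ c * q ^ (j : ℕ) ≤ d) := by
  induction m, hm using Nat.le_induction with
  | base => exact ⟨0, by simpa using hd, Or.inl rfl⟩
  | succ k hk ih =>
    by_cases h : d ≤ c * q ^ k
    · obtain ⟨j, h1, h2⟩ := ih h
      exact ⟨j.castSucc, by simpa using h1, by simpa using h2⟩
    · exact ⟨Fin.last k, by simpa using hd, Or.inr (by simpa using (not_le.1 h).le)⟩

variable [DecidableEq E]

/-- A single spectral splitting: the eigenvalues of `∑ x, ρ x` are sorted into `m` bins of ratio `q`,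
the lowest bin being unbounded below. -/
theorem exists_spectral_bins {X : Type*} [Fintype X] {m : ℕ} (hm : 0 < m) {q c : ℝ} (hq : 0 < q)
    (hqm : q ^ m = Fintype.card X) (ρ : X → Matrix E E ℂ) (h0 : ∀ x, 0 ≤ ρ x)
    (hc : ∀ x, ρ x ≤ c • (1 : Matrix E E ℂ)) (hc0 : 0 < c) :
    ∃ Q : Fin m → Matrix E E ℂ, (∑ j, Q j = 1) ∧
      (∀ j k, j ≠ k → Q j * (∑ x, ρ x) * (Q k)ᴴ = 0) ∧
      (∀ j x, Q j * ρ x * (Q j)ᴴ ≤ (q ^ (j : ℕ))⁻¹ • (Q j * (∑ x, ρ x) * (Q j)ᴴ)) ∧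
      (∀ j, Q j * (∑ x, ρ x) * (Q j)ᴴ ≤ (c * q ^ ((j : ℕ) + 1)) • (1 : Matrix E E ℂ)) := by
  have hpos : 0 ≤ ∑ x, ρ x := Finset.sum_nonneg fun x _ => h0 x
  obtain ⟨U, d, hU, hU', hd, -⟩ := exists_spectral (nonneg_iff_posSemidef.1 hpos).isHermitian
  have hle : ∑ x, ρ x ≤ (c * q ^ m) • (1 : Matrix E E ℂ) := by
    calc ∑ x, ρ x ≤ ∑ _x : X, c • (1 : Matrix E E ℂ) := Finset.sum_le_sum fun x _ => hc x
      _ = _ := by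
        rw [Finset.sum_const, Finset.card_univ, hqm, ← Nat.cast_smul_eq_nsmul ℝ, smul_smul, mul_comm]
  have hdle : ∀ i, d i ≤ c * q ^ m := by
    intro i
    have h := conj_mono hle Uᴴ
    rw [hd, conjTranspose_conjTranspose, Matrix.mul_smul, Matrix.mul_one, Matrix.smul_mul, hU',
      show Uᴴ * (U * diagonal (fun i => (d i : ℂ)) * Uᴴ) * U =
        (Uᴴ * U) * diagonal (fun i => (d i : ℂ)) * (Uᴴ * U) by simp only [Matrix.mul_assoc], hU',
      Matrix.one_mul, Matrix.mul_one, le_iff] at h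
    have h2 := h.diag_nonneg (i := i)
    simp only [Matrix.sub_apply, Matrix.smul_apply, one_apply_eq, diagonal_apply_eq] at h2
    rw [Complex.real_smul, mul_one, ← Complex.ofReal_sub, Complex.zero_le_real] at h2
    linarith
  choose b hb1 hb2 using fun i => exists_bin hm q c (d i) (hdle i)
  let ind : Fin m → E → ℝ := fun j i => if b i = j then 1 else 0
  have hQH : ∀ j, (U * diagonal (fun i => (ind j i : ℂ)) * Uᴴ)ᴴ =
      U * diagonal (fun i => (ind j i : ℂ)) * Uᴴ := by
    intro j
    rw [conjTranspose_mul, conjTranspose_mul, conjTranspose_conjTranspose,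
      diagonal_conjTranspose, Matrix.mul_assoc]
    congr 3
    ext i
    simp
  have hone : ∀ a : ℝ, a • (1 : Matrix E E ℂ) = U * diagonal (fun _ => ((a : ℝ) : ℂ)) * Uᴴ := by
    intro a
    rw [← smul_one_eq_diagonal, Matrix.mul_smul, Matrix.smul_mul, Matrix.mul_one, hU]
    rfl
  have hsm : ∀ (a : ℝ) (e : E → ℝ), a • (U * diagonal (fun i => (e i : ℂ)) * Uᴴ) =
      U * diagonal (fun i => ((a * e i : ℝ) : ℂ)) * Uᴴ := by
    intro a e
    rw [← Matrix.smul_mul, ← Matrix.mul_smul, ← diagonal_smul]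
    congr 3
    ext i
    simp
  have hQQ : ∀ j k, (U * diagonal (fun i => (ind j i : ℂ)) * Uᴴ) * (∑ x, ρ x) *
      (U * diagonal (fun i => (ind k i : ℂ)) * Uᴴ)ᴴ =
      U * diagonal (fun i => ((ind j i * d i * ind k i : ℝ) : ℂ)) * Uᴴ := by
    intro j k
    rw [hQH, hd, unitary_diagonal_mul hU', unitary_diagonal_mul hU']
  refine ⟨fun j => U * diagonal (fun i => (ind j i : ℂ)) * Uᴴ, ?_, ?_, ?_, ?_⟩
  · rw [← Finset.sum_mul, ← Finset.mul_sum]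
    have : ∑ j, diagonal (fun i => (ind j i : ℂ)) = (1 : Matrix E E ℂ) := by
      ext i k
      rw [Matrix.sum_apply]
      by_cases hik : i = k
      · subst hik
        simp only [diagonal_apply_eq, one_apply_eq, ind]
        norm_cast
        simp
      · simp [hik]
    rw [this, Matrix.mul_one, hU]
  · intro j k hjk
    rw [hQQ]
    have : (fun i => ((ind j i * d i * ind k i : ℝ) : ℂ)) = 0 := by
      ext i
      simp only [ind]
      by_cases h : b i = j
      · simp [h, hjk]
      · simp [h]
    rw [this]
    simp
  · intro j x
    rcases Nat.eq_zero_or_pos (j : ℕ) with hj | hj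
    -- In the lowest bin one symbol is merely bounded by the sum over all symbols.
    · rw [hj, pow_zero, inv_one, one_smul]
      exact conj_mono (Finset.single_le_sum (fun x _ => h0 x) (Finset.mem_univ x)) _
    -- In a higher bin the sum has eigenvalues at least `c * q ^ j`, so `c` times the projector is
    -- at most `q ^ (-j)` times the compressed sum.
    · refine (conj_mono (hc x) _).trans ?_
      dsimp only
      rw [hQQ, hone, hQH, unitary_diagonal_mul hU', unitary_diagonal_mul hU', hsm]
      apply unitary_diagonal_mono
      intro i
      simp only [ind]
      split_ifs with h
      · have h3 := (hb2 i).resolve_left (by rw [h]; omega)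
        rw [h] at h3
        rw [one_mul, mul_one, one_mul, mul_one, le_inv_mul_iff₀ (by positivity)]
        linarith
      · simp
  · intro j
    dsimp only
    rw [hQQ, hone]
    apply unitary_diagonal_mono
    intro i
    simp only [ind]
    split_ifs with h
    · have h3 := hb1 i
      rw [h] at h3
      simpa using h3
    · simp only [zero_mul]
      positivity

/-- Peeling off the last coordinate of a sum over strings. -/
theorem sum_snoc {X M : Type*} [Fintype X] [AddCommMonoid M] {n : ℕ} (f : (Fin (n + 1) → X) → M) :
    ∑ x, f x = ∑ y : Fin n → X, ∑ z : X, f (Fin.snoc y z) := by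
  rw [← Finset.sum_product', Finset.univ_product_univ,
    ← (((Equiv.prodComm _ _).trans (Fin.snocEquiv fun _ => X)).sum_comp)]
  rfl

/-- Induction on the length. Compressing by the bin projector of the last coordinate and summing
that coordinate out leaves a family on the prefixes with the same kind of bound, the constant `c`
becoming `c * q ^ (j + 1)`. The last two conclusions are the damping of a marginal that fixes the
coordinates in `p`, and the operator bound on each part. `q` is chosen so that the `m` bins exactly
cover the range up to `c * |X|`. -/
theorem exists_splitting_one {X : Type*} [Fintype X] [DecidableEq X] {m : ℕ} (hm : 0 < m) {q : ℝ}
    (hq : 0 < q) (hqm : q ^ m = Fintype.card X) (n : ℕ) :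
    ∀ (c : ℝ) (_ : 0 < c) (ρ : (Fin n → X) → Matrix E E ℂ) (_ : ∀ x, 0 ≤ ρ x)
      (_ : ∀ x, ρ x ≤ c • (1 : Matrix E E ℂ)),
    ∃ T : (Fin n → Fin m) → (Fin n → X) → Matrix E E ℂ,
      (∀ x, ∑ α, T α x = 1) ∧
      (∀ α β, α ≠ β → ∑ x, T α x * ρ x * (T β x)ᴴ = 0) ∧
      (∀ α (p : Fin n → Prop) [DecidablePred p] (a : Fin n → X),
        (∑ x, if ∀ i, p i → x i = a i then T α x * ρ x * (T α x)ᴴ else 0) ≤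
          (∏ i, if p i then (q ^ (α i : ℕ))⁻¹ else 1) • ∑ x, T α x * ρ x * (T α x)ᴴ) ∧
      (∀ α, ∑ x, T α x * ρ x * (T α x)ᴴ ≤
        (c * ∏ i, q ^ ((α i : ℕ) + 1)) • (1 : Matrix E E ℂ)) := by
  induction n with
  | zero =>
    intro c hc ρ h0 h1
    refine ⟨fun _ _ => 1, by simp, fun α β h => (h (Subsingleton.elim _ _)).elim, ?_, ?_⟩
    · intro α p _ a
      simp
    · intro α
      simpa using h1 _
  | succ n ih =>
    intro c hc ρ h0 h1
    choose Q hQ1 hQ2 hQ3 hQ4 using fun y : Fin n → X =>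
      exists_spectral_bins hm hq hqm (fun z => ρ (Fin.snoc y z)) (fun z => h0 _) (fun z => h1 _) hc
    -- The induction hypothesis is used once for each bin `j` of the last coordinate, since both the
    -- prefix family and its bound depend on `j`.
    choose T hT1 hT2 hT3 hT4 using fun j : Fin m =>
      ih (c * q ^ ((j : ℕ) + 1)) (by positivity)
        (fun y => Q y j * (∑ z, ρ (Fin.snoc y z)) * (Q y j)ᴴ)
        (fun y => conj_nonneg (Finset.sum_nonneg fun z _ => h0 _) _) (fun y => hQ4 y j)
    let S : (Fin (n + 1) → Fin m) → (Fin (n + 1) → X) → Matrix E E ℂ := fun α x =>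
      T (α (Fin.last n)) (Fin.init α) (Fin.init x) * Q (Fin.init x) (α (Fin.last n))
    have hS : ∀ α y z, S α (Fin.snoc y z) = T (α (Fin.last n)) (Fin.init α) y *
        Q y (α (Fin.last n)) := by
      intro α y z
      simp only [S, Fin.init_snoc]
    have hterm : ∀ α β y z, S α (Fin.snoc y z) * ρ (Fin.snoc y z) * (S β (Fin.snoc y z))ᴴ =
        T (α (Fin.last n)) (Fin.init α) y * (Q y (α (Fin.last n)) * ρ (Fin.snoc y z) *
          (Q y (β (Fin.last n)))ᴴ) * (T (β (Fin.last n)) (Fin.init β) y)ᴴ := by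
      intro α β y z
      rw [hS, hS, conjTranspose_mul]
      simp only [Matrix.mul_assoc]
    have hsumz : ∀ α β y, ∑ z, S α (Fin.snoc y z) * ρ (Fin.snoc y z) * (S β (Fin.snoc y z))ᴴ =
        T (α (Fin.last n)) (Fin.init α) y * (Q y (α (Fin.last n)) * (∑ z, ρ (Fin.snoc y z)) *
          (Q y (β (Fin.last n)))ᴴ) * (T (β (Fin.last n)) (Fin.init β) y)ᴴ := by
      intro α β y
      simp only [hterm, Finset.mul_sum, Finset.sum_mul]
    refine ⟨S, ?_, ?_, ?_, ?_⟩
    · intro x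
      rw [sum_snoc, Finset.sum_comm]
      simp only [S, Fin.init_snoc, Fin.snoc_last]
      simp only [← Finset.sum_mul, hT1, Matrix.one_mul, hQ1]
    · intro α β hαβ
      rw [sum_snoc]
      simp only [hsumz]
      -- Profiles with the same last entry are separated by the induction hypothesis; otherwise the
      -- cross term already vanishes for each prefix, on summing over the last symbol.
      by_cases hl : α (Fin.last n) = β (Fin.last n)
      · have hi : Fin.init α ≠ Fin.init β := by
          intro hi
          apply hαβ
          rw [← Fin.snoc_init_self α, ← Fin.snoc_init_self β, hi, hl]
        rw [← hl]
        exact hT2 _ _ _ hi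
      · refine Finset.sum_eq_zero fun y _ => ?_
        rw [hQ2 y _ _ hl]
        simp
    · intro α p _ a
      rw [sum_snoc, sum_snoc, Fin.prod_univ_castSucc]
      simp only [hsumz]
      have h3 := hT3 (α (Fin.last n)) (Fin.init α) (fun i => p i.castSucc) (fun i => a i.castSucc)
      set w : ℝ := if p (Fin.last n) then (q ^ (α (Fin.last n) : ℕ))⁻¹ else 1 with hw
      have hw0 : 0 ≤ w := by rw [hw]; split_ifs <;> positivity
      have h3' := smul_mono_right hw0 h3
      rw [smul_smul, mul_comm] at h3'
      refine le_trans ?_ h3'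
      rw [Finset.smul_sum]
      refine Finset.sum_le_sum fun y _ => ?_
      have hiff : ∀ z : X, (∀ i, p i → (Fin.snoc y z : Fin (n + 1) → X) i = a i) ↔
          (∀ i : Fin n, p i.castSucc → y i = a i.castSucc) ∧
            (p (Fin.last n) → z = a (Fin.last n)) := by
        intro z
        rw [Fin.forall_fin_succ']
        simp
      simp only [hiff]
      -- A fixed last symbol gains the damping of its bin; a free one is summed out exactly.
      by_cases hA : ∀ i : Fin n, p i.castSucc → y i = a i.castSucc
      · by_cases hp : p (Fin.last n)
        · simp only [eq_true hA, hp, true_and, forall_true_left, if_true, hterm, hw,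
            Finset.sum_ite_eq', Finset.mem_univ]
          have := conj_mono (hQ3 y (α (Fin.last n)) (a (Fin.last n)))
            (T (α (Fin.last n)) (Fin.init α) y)
          rw [Matrix.mul_smul, Matrix.smul_mul] at this
          exact this
        · have hw1 : w = 1 := by rw [hw, if_neg hp]
          simp only [eq_true hA, hp, true_and, if_true, hw1, one_smul, IsEmpty.forall_iff]
          rw [hsumz]
      · simp [hA]
    · intro α
      rw [sum_snoc, Fin.prod_univ_castSucc]
      simp only [hsumz]
      refine (hT4 (α (Fin.last n)) (Fin.init α)).trans (le_of_eq ?_)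
      congr 1
      simp only [Fin.init]
      ring

/-- Splitting of a family `ρ` of blocks dominated by `c • σ`. -/
theorem exists_splitting {X : Type*} [Fintype X] [DecidableEq X] {m : ℕ} (hm : 0 < m) {q : ℝ}
    (hq : 0 < q) (hqm : q ^ m = Fintype.card X) {n : ℕ} {c : ℝ} (hc : 0 < c)
    (ρ : (Fin n → X) → Matrix E E ℂ) (h0 : ∀ x, 0 ≤ ρ x) {σ : Matrix E E ℂ} (hσ : σ.PosDef)
    (h1 : ∀ x, ρ x ≤ c • σ) :
    ∃ T : (Fin n → Fin m) → (Fin n → X) → Matrix E E ℂ,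
      (∀ x, ∑ α, T α x = 1) ∧
      (∀ α β, α ≠ β → ∑ x, T α x * ρ x * (T β x)ᴴ = 0) ∧
      (∀ α (p : Fin n → Prop) [DecidablePred p] (a : Fin n → X),
        (∑ x, if ∀ i, p i → x i = a i then T α x * ρ x * (T α x)ᴴ else 0) ≤
          (∏ i, if p i then (q ^ (α i : ℕ))⁻¹ else 1) • ∑ x, T α x * ρ x * (T α x)ᴴ) ∧
      (∀ α, ∑ x, T α x * ρ x * (T α x)ᴴ ≤ (c * ∏ i, q ^ ((α i : ℕ) + 1)) • σ) := by
  -- Write `σ = B Bᴴ`, with `B` invertible. Conjugation by `C = B⁻¹` turns the bound `c • σ` into `c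
  -- • 1`, and `B * T α x * C` transports the splitting back.
  obtain ⟨B, hB⟩ := CStarAlgebra.nonneg_iff_eq_mul_star_self.1
    (nonneg_iff_posSemidef.2 hσ.posSemidef)
  rw [star_eq_conjTranspose] at hB
  have hBu : IsUnit B := by
    have h := hσ.isUnit
    rw [Matrix.isUnit_iff_isUnit_det] at h ⊢
    rw [hB, det_mul] at h
    exact isUnit_of_mul_isUnit_left h
  obtain ⟨u, rfl⟩ := hBu
  set B : Matrix E E ℂ := u.1
  set C : Matrix E E ℂ := u⁻¹.1
  have hBC : B * C = 1 := u.mul_inv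
  have hCB : C * B = 1 := u.inv_mul
  have hCB' : Bᴴ * Cᴴ = 1 := by rw [← conjTranspose_mul, hCB, conjTranspose_one]
  have hBC' : Cᴴ * Bᴴ = 1 := by rw [← conjTranspose_mul, hBC, conjTranspose_one]
  obtain ⟨T, hT1, hT2, hT3, hT4⟩ := exists_splitting_one hm hq hqm n c hc
    (fun x => C * ρ x * Cᴴ) (fun x => conj_nonneg (h0 x) C) (fun x => by
      refine (conj_mono (h1 x) C).trans (le_of_eq ?_)
      rw [Matrix.mul_smul, Matrix.smul_mul, hB, ← Matrix.mul_assoc, hCB, Matrix.one_mul, hCB'])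
  have hterm : ∀ α β x, (B * T α x * C) * ρ x * (B * T β x * C)ᴴ =
      B * (T α x * (C * ρ x * Cᴴ) * (T β x)ᴴ) * Bᴴ := by
    intro α β x
    simp only [conjTranspose_mul, Matrix.mul_assoc]
  refine ⟨fun α x => B * T α x * C, ?_, ?_, ?_, ?_⟩
  · intro x
    rw [← Finset.sum_mul, ← Finset.mul_sum, hT1, Matrix.mul_one, hBC]
  · intro α β h
    simp only [hterm]
    rw [← Finset.sum_mul, ← Finset.mul_sum, hT2 α β h]
    simp
  · intro α p _ a
    have := conj_mono (hT3 α p a) B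
    simp only [hterm]
    rw [Matrix.mul_smul, Matrix.smul_mul, Finset.mul_sum, Finset.sum_mul, Finset.mul_sum,
      Finset.sum_mul] at this
    refine le_trans (le_of_eq (Finset.sum_congr rfl fun x _ => ?_)) this
    split_ifs <;> simp
  · intro α
    have := conj_mono (hT4 α) B
    simp only [hterm]
    rw [Matrix.mul_smul, Matrix.smul_mul, Matrix.mul_one, ← hB, Finset.mul_sum,
      Finset.sum_mul] at this
    exact this

end Splitting

/-! ### Pinching and gentle measurement -/

section Pinching

variable {E : Type*} [Fintype E] {ι : Type*}

/-- The pinching inequality: expand the nonnegative double sum of `(A α - A β) ρ (A α - A β)ᴴ`. No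
orthogonality of the `A α` is needed. -/
theorem conj_sum_le_card_smul (G : Finset ι) (A : ι → Matrix E E ℂ) {ρ : Matrix E E ℂ}
    (hρ : 0 ≤ ρ) :
    (∑ α ∈ G, A α) * ρ * (∑ α ∈ G, A α)ᴴ ≤ (G.card : ℝ) • ∑ α ∈ G, A α * ρ * (A α)ᴴ := by
  have h : 0 ≤ ∑ α ∈ G, ∑ β ∈ G, (A α - A β) * ρ * (A α - A β)ᴴ :=
    Finset.sum_nonneg fun α _ => Finset.sum_nonneg fun β _ => conj_nonneg hρ _
  have hexp : ∑ α ∈ G, ∑ β ∈ G, (A α - A β) * ρ * (A α - A β)ᴴ =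
      (2 : ℝ) • ((G.card : ℝ) • (∑ α ∈ G, A α * ρ * (A α)ᴴ) -
        (∑ α ∈ G, A α) * ρ * (∑ α ∈ G, A α)ᴴ) := by
    have h1 : ∑ α ∈ G, ∑ β ∈ G, A α * ρ * (A β)ᴴ = (∑ α ∈ G, A α) * ρ * (∑ α ∈ G, A α)ᴴ := by
      rw [conjTranspose_sum, Finset.sum_mul, Finset.sum_mul_sum]
    have h2 : ∑ α ∈ G, ∑ β ∈ G, A β * ρ * (A α)ᴴ = (∑ α ∈ G, A α) * ρ * (∑ α ∈ G, A α)ᴴ := by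
      rw [Finset.sum_comm, h1]
    simp only [conjTranspose_sub, Matrix.sub_mul, Matrix.mul_sub, Finset.sum_sub_distrib, h1, h2,
      Finset.sum_const, Nat.cast_smul_eq_nsmul, ← Finset.smul_sum]
    rw [two_smul]
    abel
  rw [hexp] at h
  have h' := smul_mono_right (show (0 : ℝ) ≤ 2⁻¹ by norm_num) h
  rw [smul_zero, smul_smul, inv_mul_cancel₀ two_ne_zero, one_smul] at h'
  exact sub_nonneg.1 h'

theorem sum_conj_sum_of_orthogonal [DecidableEq ι] {X : Type*} [Fintype X] (G : Finset ι)
    (T : ι → X → Matrix E E ℂ) (ρ : X → Matrix E E ℂ)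
    (h : ∀ α β, α ≠ β → ∑ x, T α x * ρ x * (T β x)ᴴ = 0) :
    ∑ x, (∑ α ∈ G, T α x) * ρ x * (∑ α ∈ G, T α x)ᴴ =
      ∑ α ∈ G, ∑ x, T α x * ρ x * (T α x)ᴴ := by
  simp only [conjTranspose_sum, Finset.sum_mul, Finset.mul_sum]
  rw [Finset.sum_comm]
  simp only [Finset.sum_comm (s := Finset.univ) (t := G)]
  rw [Finset.sum_comm]
  refine Finset.sum_congr rfl fun α hα => ?_
  rw [Finset.sum_eq_single α]
  · intro β _ hβ
    exact h _ _ (Ne.symm hβ)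
  · intro h'
    exact (h' hα).elim

variable [DecidableEq E]

/-- A gentle-measurement estimate against a Hermitian contraction. -/
theorem trace_mul_conj_sub_le {K ρ : Matrix E E ℂ} (h1 : K ≤ 1) (h2 : -1 ≤ K) (hρ : 0 ≤ ρ)
    (Y : Matrix E E ℂ) {u : ℝ} (hu : 0 < u) :
    (K * (Y * ρ * Yᴴ - ρ)).trace.re ≤
      u / 2 * ((1 - Y) * ρ * (1 - Y)ᴴ).trace.re +
        1 / u * ((Y * ρ * Yᴴ).trace.re + ρ.trace.re) := by
  -- With `V, W = u(1 - Y) ± (1 + Y)`, the difference `VρVᴴ - WρWᴴ` is `4u(ρ - YρYᴴ)`, while the sum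
  -- contains only squares. `e3` then removes `(1 + Y)ρ(1 + Y)ᴴ` through the parallelogram identity.
  have e1 := trace_mul_re_nonneg (sub_nonneg.2 h2)
    (conj_nonneg hρ ((u : ℂ) • (1 - Y) + (Y + 1)))
  have e2 := trace_mul_re_nonneg (sub_nonneg.2 h1)
    (conj_nonneg hρ ((u : ℂ) • (1 - Y) - (Y + 1)))
  have e3 := trace_re_nonneg (conj_nonneg hρ (1 - Y))
  have hdiv : ∀ A B : ℝ, u / 2 * A + 1 / u * B = (u ^ 2 / 2 * A + B) / u := by
    intro A B
    field_simp
  rw [hdiv, le_div_iff₀ hu]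
  simp only [conjTranspose_sub, conjTranspose_add, conjTranspose_smul, conjTranspose_one,
    Matrix.mul_add, Matrix.add_mul, Matrix.mul_sub, Matrix.sub_mul, Matrix.one_mul, Matrix.mul_one,
    Matrix.smul_mul, Matrix.mul_smul, trace_add, trace_sub, trace_smul, Complex.add_re,
    Complex.sub_re, sub_neg_eq_add, smul_sub, smul_add, smul_eq_mul, RCLike.star_def,
    Complex.conj_ofReal, Complex.re_ofReal_mul] at e1 e2 e3 ⊢
  linarith

end Pinching

/-! ### Block-diagonal operators and diagonal blocks -/

section Blocks

variable {I E : Type*}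

theorem blockAt_sub (A B : Matrix (I × E) (I × E) ℂ) (i : I) :
    blockAt (A - B) i = blockAt A i - blockAt B i := rfl

theorem blockAt_mono {A B : Matrix (I × E) (I × E) ℂ} (h : A ≤ B) (i : I) :
    blockAt A i ≤ blockAt B i := by
  rw [le_iff] at h ⊢
  exact h.submatrix fun e => (i, e)

variable [Fintype I] [DecidableEq I]

/-- The block-diagonal operator `∑ i, |i⟩⟨i| ⊗ A i`. -/
def blockSum (A : I → Matrix E E ℂ) : Matrix (I × E) (I × E) ℂ :=
  ∑ i, Matrix.single i i (1 : ℂ) ⊗ₖ A i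

theorem blockSum_sub (A B : I → Matrix E E ℂ) :
    blockSum A - blockSum B = blockSum fun i => A i - B i := by
  simp only [blockSum, ← Finset.sum_sub_distrib]
  refine Finset.sum_congr rfl fun i _ => ?_
  ext a b
  simp [kroneckerMap_apply, mul_sub]

theorem smul_blockSum (c : ℝ) (A : I → Matrix E E ℂ) :
    c • blockSum A = blockSum fun i => c • A i := by
  simp only [blockSum, Finset.smul_sum]
  refine Finset.sum_congr rfl fun i _ => ?_
  ext a b
  simp [kroneckerMap_apply, mul_left_comm]

theorem sum_single_eq_one : ∑ i : I, Matrix.single i i (1 : ℂ) = 1 := by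
  ext a b
  rw [Matrix.sum_apply]
  by_cases h : a = b
  · subst h; simp [Matrix.single_apply]
  · rw [Matrix.one_apply_ne h]
    refine Finset.sum_eq_zero fun i _ => ?_
    rw [Matrix.single_apply, if_neg]
    rintro ⟨rfl, rfl⟩
    exact h rfl

theorem one_kronecker_eq_blockSum (N : Matrix E E ℂ) :
    (1 : Matrix I I ℂ) ⊗ₖ N = blockSum fun _ => N := by
  rw [blockSum, ← sum_single_eq_one]
  ext a b
  simp [kroneckerMap_apply, Matrix.sum_apply, Finset.sum_mul]

theorem blockAt_blockSum (A : I → Matrix E E ℂ) (i : I) : blockAt (blockSum A) i = A i := by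
  ext a b
  simp [blockAt, blockSum, Matrix.sum_apply, kroneckerMap_apply, Matrix.single_apply]

theorem blockSum_one [DecidableEq E] : blockSum (fun _ : I => (1 : Matrix E E ℂ)) = 1 := by
  rw [← one_kronecker_eq_blockSum, one_kronecker_one]

theorem blockAt_one [DecidableEq E] (i : I) : blockAt (1 : Matrix (I × E) (I × E) ℂ) i = 1 := by
  rw [← blockSum_one, blockAt_blockSum]

theorem blockAt_le_one [DecidableEq E] {K : Matrix (I × E) (I × E) ℂ} (h : K ≤ 1) (i : I) :
    blockAt K i ≤ 1 := by
  simpa [blockAt_one] using blockAt_mono h i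

theorem neg_one_le_blockAt [DecidableEq E] {K : Matrix (I × E) (I × E) ℂ} (h : -1 ≤ K) (i : I) :
    -1 ≤ blockAt K i := by
  have := blockAt_mono h i
  rwa [show blockAt (-1 : Matrix (I × E) (I × E) ℂ) i = - blockAt 1 i from rfl, blockAt_one] at this

variable [Fintype E]

theorem blockSum_nonneg {A : I → Matrix E E ℂ} (h : ∀ i, 0 ≤ A i) : 0 ≤ blockSum A := by
  refine Finset.sum_nonneg fun i _ => ?_
  rw [nonneg_iff_posSemidef]
  refine PosSemidef.kronecker ?_ (nonneg_iff_posSemidef.1 (h i))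
  have heq : Matrix.single i i (1 : ℂ) = vecMulVec (Pi.single i 1) (star (Pi.single i 1)) := by
    ext a b
    simp only [Matrix.single_apply, vecMulVec_apply, Pi.single_apply, Pi.star_apply,
      eq_comm (a := i)]
    by_cases ha : a = i <;> by_cases hb : b = i <;> simp [ha, hb]
  rw [heq]
  exact posSemidef_vecMulVec_self_star _

theorem blockSum_mono {A B : I → Matrix E E ℂ} (h : ∀ i, A i ≤ B i) : blockSum A ≤ blockSum B := by
  rw [← sub_nonneg, blockSum_sub]
  exact blockSum_nonneg fun i => sub_nonneg.2 (h i)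

theorem trace_mul_blockSum (K : Matrix (I × E) (I × E) ℂ) (A : I → Matrix E E ℂ) :
    (K * blockSum A).trace = ∑ i, (blockAt K i * A i).trace := by
  have hsum : ∀ p q : I × E, blockSum A p q = if p.1 = q.1 then A p.1 p.2 q.2 else 0 := by
    intro p q
    simp only [blockSum, Matrix.sum_apply, kroneckerMap_apply, Matrix.single_apply]
    split_ifs with h
    · simp [h]
    · refine Finset.sum_eq_zero fun i _ => ?_
      rw [if_neg, zero_mul]
      rintro ⟨h1, h2⟩
      exact h (h1.symm.trans h2)
  simp only [Matrix.trace, Matrix.diag, Matrix.mul_apply, Fintype.sum_prod_type, hsum, blockAt,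
    Matrix.of_apply]
  refine Finset.sum_congr rfl fun i _ => Finset.sum_congr rfl fun e _ => ?_
  rw [Finset.sum_eq_single i]
  · simp
  · intro j _ hj
    simp [hj]
  · simp

variable [DecidableEq E]

theorem trace_blockSum (A : I → Matrix E E ℂ) : (blockSum A).trace = ∑ i, (A i).trace := by
  have := trace_mul_blockSum 1 A
  simpa [blockAt_one] using this

theorem trace_eq_sum_blockAt (M : Matrix (I × E) (I × E) ℂ) :
    M.trace = ∑ i, (blockAt M i).trace := by
  have := trace_mul_blockSum M (fun _ => 1)
  simpa [blockSum_one] using this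

/-- Pairing the diagonal blocks with contractions is bounded by the trace norm. -/
theorem sum_trace_mul_blockAt_le {M : Matrix (I × E) (I × E) ℂ} (hM : M.IsHermitian)
    {K : I → Matrix E E ℂ} (h1 : ∀ i, K i ≤ 1) (h2 : ∀ i, -1 ≤ K i) :
    ∑ i, (K i * blockAt M i).trace.re ≤ traceNorm M := by
  have h := trace_mul_le_traceNorm hM (K := blockSum K) ?_ ?_
  · rw [trace_mul_comm, trace_mul_blockSum, Complex.re_sum] at h
    refine le_trans (le_of_eq (Finset.sum_congr rfl fun i _ => ?_)) h
    rw [trace_mul_comm]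
  · rw [← blockSum_one]
    exact blockSum_mono h1
  · rw [← sub_nonneg, sub_neg_eq_add, ← sub_neg_eq_add, ← blockSum_one]
    have : -blockSum (fun _ : I => (1 : Matrix E E ℂ)) = blockSum fun _ => -1 := by
      have := blockSum_sub (fun _ : I => (0 : Matrix E E ℂ)) (fun _ => 1)
      simpa [show blockSum (fun _ : I => (0 : Matrix E E ℂ)) = 0 by simp [blockSum]] using this
    rw [this, sub_nonneg]
    exact blockSum_mono h2

end Blocks

/-! ### Completing subnormalised operators to states -/

section States

variable {I : Type*} [Fintype I]

theorem trace_eq_ofReal {A : Matrix I I ℂ} (hA : 0 ≤ A) : A.trace = (A.trace.re : ℂ) := by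
  have := (nonneg_iff_posSemidef.1 hA).trace_nonneg
  exact Complex.ext (by simp) (by simpa using (Complex.le_def.1 this).2.symm)

/-- The missing trace is added as a multiple of the identity. -/
theorem exists_isState_ge [DecidableEq I] [Nonempty I] {σ : Matrix I I ℂ} (h0 : 0 ≤ σ)
    (h1 : σ.trace.re ≤ 1) :
    ∃ σ' : Matrix I I ℂ, IsState σ' ∧ σ ≤ σ' := by
  have hd : (0 : ℝ) < Fintype.card I := by exact_mod_cast Fintype.card_pos
  have hp : 0 ≤ ((1 - σ.trace.re) / Fintype.card I : ℝ) • (1 : Matrix I I ℂ) := by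
    have := smul_mono_right (show 0 ≤ ((1 - σ.trace.re) / Fintype.card I : ℝ) from
      div_nonneg (by linarith) hd.le) (nonneg_iff_posSemidef.2 (PosSemidef.one (n := I) (R := ℂ)))
    simpa using this
  refine ⟨σ + ((1 - σ.trace.re) / Fintype.card I : ℝ) • 1, ⟨?_, ?_⟩, le_add_of_nonneg_right hp⟩
  · exact nonneg_iff_posSemidef.1 (add_nonneg h0 hp)
  · rw [trace_add, trace_smul, trace_one, trace_eq_ofReal h0, Complex.real_smul]
    norm_cast
    field_simp
    ring

end States

/-! ### Block form of the sampled state -/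

theorem substring_eq_iff {n r : ℕ} {X : Type*} (x a : Fin n → X) (s : Sample n r) :
    substring x s = substring a s ↔ ∀ i, i ∈ s.1 → x i = a i := by
  constructor
  · intro h i hi
    have : i ∈ Set.range (s.1.orderEmbOfFin s.2) := by
      rw [Finset.range_orderEmbOfFin]; exact hi
    obtain ⟨k, rfl⟩ := this
    exact congrFun h k
  · intro h
    funext k
    exact h _ (Finset.orderEmbOfFin_mem _ _ _)

theorem sampledState_eq_blockSum {n r : ℕ} {X E : Type*} [Fintype X] [DecidableEq X]
    (P : Sample n r → ℝ) (ρ : Matrix ((Fin n → X) × E) ((Fin n → X) × E) ℂ) :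
    sampledState P ρ = blockSum fun z => blockSum fun s =>
      P s • ∑ x with substring x s = z, blockAt ρ x := by
  have h : ∀ z (s : Sample n r), Matrix.single z z (1 : ℂ) ⊗ₖ (Matrix.single s s (1 : ℂ) ⊗ₖ
      (P s • ∑ x with substring x s = z, blockAt ρ x)) =
      P s • ∑ x with substring x s = z, Matrix.single (substring x s) (substring x s) (1 : ℂ) ⊗ₖ
        (Matrix.single s s (1 : ℂ) ⊗ₖ blockAt ρ x) := by
    intro z s
    ext a b
    simp only [kroneckerMap_apply, Matrix.smul_apply, Matrix.sum_apply, Finset.mul_sum,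
      Finset.smul_sum]
    refine Finset.sum_congr rfl fun x hx => ?_
    rw [(Finset.mem_filter.1 hx).2]
    simp only [Complex.real_smul]
    ring
  have h2 : ∀ z : Fin r → X, Matrix.single z z (1 : ℂ) ⊗ₖ (blockSum fun s =>
      P s • ∑ x with substring x s = z, blockAt ρ x) = ∑ s, Matrix.single z z (1 : ℂ) ⊗ₖ
        (Matrix.single s s (1 : ℂ) ⊗ₖ (P s • ∑ x with substring x s = z, blockAt ρ x)) := by
    intro z
    ext a b
    simp only [blockSum, kroneckerMap_apply, Matrix.sum_apply, Finset.mul_sum]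
  rw [blockSum]
  simp only [h2, h]
  rw [Finset.sum_comm, sampledState]
  refine Finset.sum_congr rfl fun s _ => ?_
  rw [← Finset.smul_sum, Finset.sum_fiberwise]

/-! ### The smoothed sampled state -/

section Core

variable {X E : Type*} [Fintype X] [DecidableEq X] [Fintype E]

/-- The marginal on the sampled positions of the part of the state with profiles in `G`. -/
theorem marginal_le {n r m : ℕ} {q Θ : ℝ} (hq : 0 < q) {R : (Fin n → X) → Matrix E E ℂ}
    (hR : ∀ x, 0 ≤ R x) {T : (Fin n → Fin m) → (Fin n → X) → Matrix E E ℂ}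
    (hT : ∀ α (p : Fin n → Prop) [DecidablePred p] (a : Fin n → X),
        (∑ x, if ∀ i, p i → x i = a i then T α x * R x * (T α x)ᴴ else 0) ≤
          (∏ i, if p i then (q ^ (α i : ℕ))⁻¹ else 1) • ∑ x, T α x * R x * (T α x)ᴴ)
    {b : (Fin n → Fin m) → ℝ} {ς : (Fin n → Fin m) → Matrix E E ℂ} (hς : ∀ α, 0 ≤ ς α)
    (hb : ∀ α, ∑ x, T α x * R x * (T α x)ᴴ ≤ b α • ς α)
    (s : Sample n r) (G : Finset (Fin n → Fin m)) (hΘ0 : 0 ≤ Θ)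
    (hΘ : ∀ α ∈ G, (∏ i ∈ s.1, (q ^ (α i : ℕ))⁻¹) * b α ≤ Θ) (z : Fin r → X) :
    ∑ x with substring x s = z, (∑ α ∈ G, T α x) * R x * (∑ α ∈ G, T α x)ᴴ ≤
      ((m : ℝ) ^ n * Θ) • ∑ α, ς α := by
  have hnn : 0 ≤ ((m : ℝ) ^ n * Θ) • ∑ α, ς α := by
    have := smul_mono_right (show 0 ≤ (m : ℝ) ^ n * Θ by positivity)
      (Finset.sum_nonneg fun α (_ : α ∈ Finset.univ) => hς α)
    rwa [smul_zero] at this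
  by_cases hz : ∃ a, substring a s = z
  swap
  · have : (Finset.univ.filter fun x : Fin n → X => substring x s = z) = ∅ := by
      ext x
      simpa using fun h => hz ⟨x, h⟩
    rw [this, Finset.sum_empty]
    exact hnn
  obtain ⟨a, rfl⟩ := hz
  have hcard : (G.card : ℝ) ≤ (m : ℝ) ^ n := by
    have : G.card ≤ m ^ n := by
      refine (Finset.card_le_univ G).trans (le_of_eq ?_)
      simp
    exact_mod_cast this
  have hper : ∀ α ∈ G, ∑ x with substring x s = substring a s, T α x * R x * (T α x)ᴴ ≤
      Θ • ς α := by
    intro α hα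
    have h1 := hT α (fun i => i ∈ s.1) a
    rw [← Finset.sum_filter] at h1
    simp only [substring_eq_iff]
    refine h1.trans ?_
    rw [Finset.prod_ite_mem, Finset.univ_inter]
    have hp : 0 ≤ ∏ i ∈ s.1, (q ^ (α i : ℕ))⁻¹ := Finset.prod_nonneg fun i _ => by positivity
    refine (smul_mono_right hp (hb α)).trans ?_
    rw [smul_smul]
    exact smul_mono_left (hΘ α hα) (hς α)
  -- Pinching costs the number of profiles in `G`; each profile then contributes its damped
  -- marginal, at most `Θ • ς α`.
  calc ∑ x with substring x s = substring a s, (∑ α ∈ G, T α x) * R x * (∑ α ∈ G, T α x)ᴴ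
      ≤ ∑ x with substring x s = substring a s,
          (G.card : ℝ) • ∑ α ∈ G, T α x * R x * (T α x)ᴴ :=
        Finset.sum_le_sum fun x _ => conj_sum_le_card_smul G _ (hR x)
    _ = (G.card : ℝ) • ∑ α ∈ G, ∑ x with substring x s = substring a s,
          T α x * R x * (T α x)ᴴ := by
        rw [← Finset.smul_sum, Finset.sum_comm]
    _ ≤ (G.card : ℝ) • ∑ α ∈ G, Θ • ς α :=
        smul_mono_right (Nat.cast_nonneg _) (Finset.sum_le_sum hper)
    _ = (G.card * Θ) • ∑ α ∈ G, ς α := by rw [← Finset.smul_sum, smul_smul]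
    _ ≤ ((m : ℝ) ^ n * Θ) • ∑ α ∈ G, ς α :=
        smul_mono_left (mul_le_mul_of_nonneg_right hcard hΘ0) (Finset.sum_nonneg fun α _ => hς α)
    _ ≤ _ := smul_mono_right (by positivity)
        (Finset.sum_le_univ_sum_of_nonneg hς)

/-- Discarding the profiles outside `G` moves the state by at most `2 √δ`. -/
theorem sum_trace_mul_conj_sub_le [DecidableEq E] {ι Y : Type*} [Fintype ι] [DecidableEq ι]
    [Fintype Y] {R : Y → Matrix E E ℂ} (hR : ∀ x, 0 ≤ R x) {T : ι → Y → Matrix E E ℂ}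
    (hT1 : ∀ x, ∑ α, T α x = 1)
    (hT2 : ∀ α β, α ≠ β → ∑ x, T α x * R x * (T β x)ᴴ = 0)
    (hR1 : (∑ x, R x).trace.re ≤ 1) (G : Finset ι) {δ : ℝ} (hδ : 0 < δ)
    (hG : ∑ α ∈ Gᶜ, (∑ x, T α x * R x * (T α x)ᴴ).trace.re ≤ δ)
    {K : Y → Matrix E E ℂ} (hK1 : ∀ x, K x ≤ 1) (hK2 : ∀ x, -1 ≤ K x) :
    ∑ x, (K x * ((∑ α ∈ G, T α x) * R x * (∑ α ∈ G, T α x)ᴴ - R x)).trace.re ≤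
      2 * Real.sqrt δ := by
  have hsδ : 0 < Real.sqrt δ := Real.sqrt_pos.2 hδ
  -- This `u` balances the two error terms `u/2 * δ` and `2/u`, each becoming `√δ`.
  have hu : 0 < 2 / Real.sqrt δ := by positivity
  have hcompl : ∀ x, 1 - ∑ α ∈ G, T α x = ∑ α ∈ Gᶜ, T α x := by
    intro x
    rw [← hT1 x, ← Finset.sum_add_sum_compl G, add_sub_cancel_left]
  have hsumtr : ∀ H : Finset ι, ∑ x, ((∑ α ∈ H, T α x) * R x * (∑ α ∈ H, T α x)ᴴ).trace.re =
      ∑ α ∈ H, (∑ x, T α x * R x * (T α x)ᴴ).trace.re := by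
    intro H
    rw [← Complex.re_sum, ← trace_sum, sum_conj_sum_of_orthogonal H T R hT2, trace_sum,
      Complex.re_sum]
  have hw0 : ∀ α, 0 ≤ (∑ x, T α x * R x * (T α x)ᴴ).trace.re := fun α =>
    trace_re_nonneg (Finset.sum_nonneg fun x _ => conj_nonneg (hR x) _)
  have htot : ∑ α, (∑ x, T α x * R x * (T α x)ᴴ).trace.re = (∑ x, R x).trace.re := by
    rw [← hsumtr Finset.univ, trace_sum, Complex.re_sum]
    simp [hT1]
  have hY : ∑ x, ((∑ α ∈ G, T α x) * R x * (∑ α ∈ G, T α x)ᴴ).trace.re ≤ 1 := by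
    rw [hsumtr]
    exact (Finset.sum_le_univ_sum_of_nonneg hw0).trans (htot.trans_le hR1)
  have hR1' : ∑ x, (R x).trace.re ≤ 1 := by rwa [trace_sum, Complex.re_sum] at hR1
  calc _ ≤ ∑ x, ((2 / Real.sqrt δ) / 2 *
          ((1 - ∑ α ∈ G, T α x) * R x * (1 - ∑ α ∈ G, T α x)ᴴ).trace.re +
        1 / (2 / Real.sqrt δ) * (((∑ α ∈ G, T α x) * R x * (∑ α ∈ G, T α x)ᴴ).trace.re +
          (R x).trace.re)) :=
        Finset.sum_le_sum fun x _ => trace_mul_conj_sub_le (hK1 x) (hK2 x) (hR x) _ hu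
    _ = (2 / Real.sqrt δ) / 2 * ∑ α ∈ Gᶜ, (∑ x, T α x * R x * (T α x)ᴴ).trace.re +
        1 / (2 / Real.sqrt δ) * (∑ x, ((∑ α ∈ G, T α x) * R x * (∑ α ∈ G, T α x)ᴴ).trace.re +
          ∑ x, (R x).trace.re) := by
        simp only [hcompl]
        rw [Finset.sum_add_distrib, ← Finset.mul_sum, ← Finset.mul_sum, Finset.sum_add_distrib,
          hsumtr Gᶜ]
    _ ≤ (2 / Real.sqrt δ) / 2 * δ + 1 / (2 / Real.sqrt δ) * (1 + 1) := by
        gcongr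
    _ = 2 * Real.sqrt δ := by
        have := Real.mul_self_sqrt hδ.le
        field_simp
        nlinarith

theorem trace_mul_nested_blockSum [DecidableEq E] {n r : ℕ}
    (K : Matrix ((Fin r → X) × (Sample n r × E)) ((Fin r → X) × (Sample n r × E)) ℂ)
    (P : Sample n r → ℝ) (R : Sample n r → (Fin n → X) → Matrix E E ℂ) :
    (K * blockSum fun z => blockSum fun s =>
      P s • ∑ x with substring x s = z, R s x).trace.re =
      ∑ s, P s * ∑ x, (blockAt (blockAt K (substring x s)) s * R s x).trace.re := by
  simp only [trace_mul_blockSum, Matrix.mul_smul, trace_smul, Matrix.mul_sum, trace_sum,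
    Complex.re_sum, Complex.real_smul, Complex.re_ofReal_mul]
  rw [Finset.sum_comm]
  refine Finset.sum_congr rfl fun s _ => ?_
  rw [← Finset.mul_sum]
  congr 1
  rw [← Finset.sum_fiberwise (s := Finset.univ) (g := fun x => substring x s)]
  refine Finset.sum_congr rfl fun z _ => Finset.sum_congr rfl fun x hx => ?_
  rw [(Finset.mem_filter.1 hx).2]

theorem sampledState_nonneg {n r : ℕ} {P : Sample n r → ℝ} (hP : ∀ s, 0 ≤ P s)
    {ρ : Matrix ((Fin n → X) × E) ((Fin n → X) × E) ℂ} (hρ : ρ.PosSemidef) :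
    0 ≤ sampledState P ρ := by
  rw [sampledState_eq_blockSum]
  refine blockSum_nonneg fun z => blockSum_nonneg fun s => ?_
  have := smul_mono_right (hP s)
    (Finset.sum_nonneg fun x (_ : x ∈ Finset.univ.filter fun x => substring x s = z) =>
      blockAt_mono (nonneg_iff_posSemidef.2 hρ) x)
  rwa [smul_zero] at this

theorem traceNorm_zero_sub_sampledState_le [DecidableEq E] {n r : ℕ} {P : Sample n r → ℝ}
    (hP : P ∈ stdSimplex ℝ (Sample n r)) {ρ : Matrix ((Fin n → X) × E) ((Fin n → X) × E) ℂ}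
    (hρ : IsState ρ) : traceNorm (0 - sampledState P ρ) ≤ 1 := by
  have h0 := sampledState_nonneg hP.1 hρ.1
  refine traceNorm_le_of_forall (isHermitian_zero.sub (nonneg_iff_posSemidef.1 h0).isHermitian)
    fun K _ hK => ?_
  have h1 := trace_mul_re_nonneg (sub_nonneg.2 hK) h0
  have h2 := trace_mul_nested_blockSum (1 : Matrix ((Fin r → X) × (Sample n r × E)) _ ℂ) P
    fun _ x => blockAt ρ x
  rw [← sampledState_eq_blockSum] at h2
  simp only [blockAt_one, Matrix.one_mul, ← Complex.re_sum, ← trace_eq_sum_blockAt, hρ.2] at h2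
  rw [Complex.one_re, ← Finset.sum_mul, mul_one, hP.2] at h2
  rw [sub_neg_eq_add, Matrix.add_mul, Matrix.one_mul, trace_add, Complex.add_re] at h1
  rw [zero_sub, Matrix.mul_neg, trace_neg, Complex.neg_re]
  linarith

open Classical in
/-- A smoothed version of the sampled state, with an explicit operator bound. -/
theorem exists_smoothed_sampledState [DecidableEq E] {n r m : ℕ} (hm : 0 < m) {q : ℝ} (hq : 0 < q)
    (hqm : q ^ m = Fintype.card X)
    {ρ ρ' : Matrix ((Fin n → X) × E) ((Fin n → X) × E) ℂ} (hρ : IsState ρ)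
    (hρ' : IsSubnormalizedState ρ') {τ : ℝ} (hτ : traceNorm (ρ' - ρ) ≤ τ)
    {σ : Matrix E E ℂ} (hσ : IsState σ) (hσ' : σ.PosDef) {t : ℝ} (ht : 0 < t)
    (hle : (t • ((1 : Matrix (Fin n → X) (Fin n → X) ℂ) ⊗ₖ σ) - ρ').PosSemidef)
    {ξ δ ε : ℝ} {P : Sample n r → ℝ} (hP : IsParallelSampler ξ δ ε P)
    {Θ : ℝ} (hΘ0 : 0 < Θ)
    (hΘ : ∀ (s : Sample n r) (α : Fin n → Fin m),
      (1 / (n : ℝ)) * ∑ i, ((α i : ℕ) : ℝ) / m - ξ < (1 / (r : ℝ)) * ∑ i ∈ s.1, ((α i : ℕ) : ℝ) / m →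
      (∏ i ∈ s.1, (q ^ (α i : ℕ))⁻¹) * min 1 (t * ∏ i, q ^ ((α i : ℕ) + 1)) ≤ Θ) :
    ∃ F : Matrix ((Fin r → X) × (Sample n r × E)) ((Fin r → X) × (Sample n r × E)) ℂ,
      IsSubnormalizedState F ∧ traceNorm (F - sampledState P ρ) ≤ 2 * Real.sqrt δ + ε + τ ∧
      ∃ σ' : Matrix (Sample n r × E) (Sample n r × E) ℂ, IsState σ' ∧
        ((((m : ℝ) ^ n) ^ 2 * Θ) • ((1 : Matrix (Fin r → X) (Fin r → X) ℂ) ⊗ₖ σ') - F).PosSemidef := by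
  obtain ⟨hP1, -⟩ := hP 0
  set R : (Fin n → X) → Matrix E E ℂ := fun x => blockAt ρ' x
  have hR0 : ∀ x, 0 ≤ R x := fun x => by
    have := blockAt_mono (nonneg_iff_posSemidef.2 hρ'.1) x
    exact this
  have hRσ : ∀ x, R x ≤ t • σ := fun x => by
    have := blockAt_mono (le_iff.2 hle) x
    rwa [one_kronecker_eq_blockSum, smul_blockSum, blockAt_blockSum] at this
  have hR1 : (∑ x, R x).trace.re ≤ 1 := by
    rw [trace_sum, ← trace_eq_sum_blockAt]
    exact hρ'.2
  obtain ⟨T, hT1, hT2, hT3, hT4⟩ := exists_splitting hm hq hqm ht R hR0 hσ' hRσ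
  set Rb : (Fin n → Fin m) → Matrix E E ℂ := fun α => ∑ x, T α x * R x * (T α x)ᴴ
  have hRb0 : ∀ α, 0 ≤ Rb α := fun α => Finset.sum_nonneg fun x _ => conj_nonneg (hR0 x) _
  set w : (Fin n → Fin m) → ℝ := fun α => (Rb α).trace.re
  have hw0 : ∀ α, 0 ≤ w α := fun α => trace_re_nonneg (hRb0 α)
  have hsumtr : ∀ H : Finset (Fin n → Fin m),
      ∑ x, ((∑ α ∈ H, T α x) * R x * (∑ α ∈ H, T α x)ᴴ).trace.re = ∑ α ∈ H, w α := by
    intro H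
    rw [← Complex.re_sum, ← trace_sum, sum_conj_sum_of_orthogonal H T R hT2, trace_sum,
      Complex.re_sum]
  have hwtot : ∑ α, w α = (∑ x, R x).trace.re := by
    rw [← hsumtr Finset.univ, trace_sum, Complex.re_sum]
    simp [hT1]
  have hw1 : ∑ α, w α ≤ 1 := hwtot.trans_le hR1
  have hw1' : ∀ α, w α ≤ 1 := fun α =>
    (Finset.single_le_sum (fun α _ => hw0 α) (Finset.mem_univ α)).trans hw1
  have hN : (0 : ℝ) < (m : ℝ) ^ n := by positivity
  have hcard : (Fintype.card (Fin n → Fin m) : ℝ) = (m : ℝ) ^ n := by simp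
  -- reference operators
  obtain ⟨ς, hς0, hς1, hςb⟩ : ∃ ς : (Fin n → Fin m) → Matrix E E ℂ, (∀ α, 0 ≤ ς α) ∧
      (∀ α, (ς α).trace.re ≤ 1) ∧
      ∀ α, Rb α ≤ (min 1 (t * ∏ i, q ^ ((α i : ℕ) + 1))) • ς α := by
    -- When the bound from `σ` is weaker than `1`, the part `Rb α` serves as its own reference, its
    -- trace being at most `1`. This is the origin of `min 1`.
    refine ⟨fun α => if 1 ≤ t * ∏ i, q ^ ((α i : ℕ) + 1) then Rb α else σ, ?_, ?_, ?_⟩ <;>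
      intro α <;> dsimp only <;> split_ifs with h
    · exact hRb0 α
    · exact nonneg_iff_posSemidef.2 hσ.1
    · exact hw1' α
    · rw [hσ.2]; simp
    · rw [min_eq_left h, one_smul]
    · rw [min_eq_right (not_le.1 h).le]
      exact hT4 α
  -- the sampler
  let M := Fintype.card (Fin n → Fin m)
  let e : (Fin n → Fin m) ≃ Fin M := Fintype.equivFin _
  -- The weights `w` may sum to less than `1`. The missing mass is spread uniformly, so that the
  -- sampler applies to `ω` and bounds `w` a fortiori.
  let ω : (Fin n → Fin m) → ℝ := fun α => w α + (1 - ∑ α, w α) / (m : ℝ) ^ n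
  have hwω : ∀ α, w α ≤ ω α := fun α => by
    have : 0 ≤ (1 - ∑ α, w α) / (m : ℝ) ^ n := div_nonneg (by linarith) hN.le
    simp only [ω]
    linarith
  let β : Fin M → Fin n → ℝ := fun k i => ((e.symm k i : ℕ) : ℝ) / m
  let G : Sample n r → Finset (Fin n → Fin m) := fun s =>
    Finset.univ.filter fun α => e α ∉ badRows β s.1 ξ
  have hsamp : (∑ s with δ ≤ ∑ α ∈ (G s)ᶜ, ω α, P s) ≤ ε := by
    have h := (hP M).2 (ω ∘ e.symm) ?_ β ?_
    · refine le_trans (le_of_eq ?_) h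
      have hs : ∀ s : Sample n r, ∑ α ∈ (G s)ᶜ, ω α =
          ∑ k with k ∈ badRows β s.1 ξ, (ω ∘ e.symm) k := by
        intro s
        refine Finset.sum_equiv e ?_ ?_
        · intro α
          simp [G]
        · intro α _
          simp
      simp only [hs]
    · refine ⟨fun k => (hw0 _).trans (hwω _), ?_⟩
      rw [Function.comp_def, e.symm.sum_comp ω]
      simp only [ω]
      rw [Finset.sum_add_distrib, Finset.sum_const, Finset.card_univ, nsmul_eq_mul, hcard]
      field_simp
      ring
    · intro k i
      refine ⟨by positivity, ?_⟩
      rw [div_le_one (by exact_mod_cast hm)]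
      exact_mod_cast (e.symm k i).2.le
  -- the smoothed state
  let good : Sample n r → Prop := fun s => ∑ α ∈ (G s)ᶜ, ω α < δ
  -- Samples on which the sampler fails are sent to zero; on the others only the bad profiles are
  -- discarded.
  let R' : Sample n r → (Fin n → X) → Matrix E E ℂ := fun s x =>
    if good s then (∑ α ∈ G s, T α x) * R x * (∑ α ∈ G s, T α x)ᴴ else 0
  have hR'0 : ∀ s x, 0 ≤ R' s x := by
    intro s x
    simp only [R']
    split_ifs
    · exact conj_nonneg (hR0 x) _
    · exact le_rfl
  have hR'1 : ∀ s, ∑ x, (R' s x).trace.re ≤ 1 := by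
    intro s
    simp only [R']
    split_ifs
    · rw [hsumtr]
      exact (Finset.sum_le_univ_sum_of_nonneg hw0).trans hw1
    · simp
  have hF0 : 0 ≤ blockSum fun z : Fin r → X => blockSum fun s =>
      P s • ∑ x with substring x s = z, R' s x := by
    refine blockSum_nonneg fun z => blockSum_nonneg fun s => ?_
    have := smul_mono_right (hP1.1 s)
      (Finset.sum_nonneg fun x (_ : x ∈ Finset.univ.filter fun x => substring x s = z) => hR'0 s x)
    rwa [smul_zero] at this
  refine ⟨blockSum fun z => blockSum fun s => P s • ∑ x with substring x s = z, R' s x,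
    ⟨nonneg_iff_posSemidef.1 hF0, ?_⟩, ?_, ?_⟩
  · have h := trace_mul_nested_blockSum 1 P R'
    simp only [blockAt_one, Matrix.one_mul] at h
    rw [h, ← hP1.2]
    refine Finset.sum_le_sum fun s _ => ?_
    exact mul_le_of_le_one_right (hP1.1 s) (hR'1 s)
  · have hS0 : 0 ≤ sampledState P ρ := sampledState_nonneg hP1.1 hρ.1
    refine traceNorm_le_of_forall ((nonneg_iff_posSemidef.1 hF0).isHermitian.sub
      (nonneg_iff_posSemidef.1 hS0).isHermitian) fun K hK1 hK2 => ?_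
    rw [Matrix.mul_sub, trace_sub, Complex.sub_re, sampledState_eq_blockSum,
      trace_mul_nested_blockSum, trace_mul_nested_blockSum K P fun _ x => blockAt ρ x,
      ← Finset.sum_sub_distrib]
    have hk1 : ∀ s x, blockAt (blockAt K (substring x s)) s ≤ 1 := fun s x =>
      blockAt_le_one (blockAt_le_one hK1 _) _
    have hk2 : ∀ s x, -1 ≤ blockAt (blockAt K (substring x s)) s := fun s x =>
      neg_one_le_blockAt (neg_one_le_blockAt hK2 _) _
    -- For each `s` the test operators depend on `x` only through blocks, so the smoothing error
    -- stays at most `τ`, even if `ρ'` is not classical.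
    have hB : ∀ s, ∑ x, (blockAt (blockAt K (substring x s)) s * blockAt (ρ' - ρ) x).trace.re ≤ τ :=
      fun s => (sum_trace_mul_blockAt_le (hρ'.1.isHermitian.sub hρ.1.isHermitian)
        (hk1 s) (hk2 s)).trans hτ
    have hA : ∀ s, ∑ x, (blockAt (blockAt K (substring x s)) s * (R' s x - R x)).trace.re ≤
        2 * Real.sqrt δ + if δ ≤ ∑ α ∈ (G s)ᶜ, ω α then 1 else 0 := by
      intro s
      by_cases hg : good s
      · rw [if_neg (not_le.2 hg), add_zero]
        simp only [R', if_pos hg]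
        -- A sample can be good only if `δ > 0`, so `δ = 0` needs no separate gentle-measurement
        -- bound.
        have hδ : 0 < δ := lt_of_le_of_lt
          (Finset.sum_nonneg fun α _ => (hw0 α).trans (hwω α)) hg
        refine sum_trace_mul_conj_sub_le hR0 hT1 hT2 hR1 (G s) hδ ?_ (hk1 s) (hk2 s)
        exact (Finset.sum_le_sum fun α _ => hwω α).trans hg.le
      · rw [if_pos (not_lt.1 hg)]
        simp only [R', if_neg hg, zero_sub]
        have : ∑ x, (blockAt (blockAt K (substring x s)) s * (- R x)).trace.re ≤
            ∑ x, (R x).trace.re := by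
          refine Finset.sum_le_sum fun x _ => ?_
          have := trace_mul_re_nonneg (sub_nonneg.2 (hk2 s x)) (hR0 x)
          rw [sub_neg_eq_add, Matrix.add_mul, Matrix.one_mul, trace_add, Complex.add_re] at this
          rw [Matrix.mul_neg, trace_neg, Complex.neg_re]
          linarith
        have h2 := Real.sqrt_nonneg δ
        rw [trace_sum, Complex.re_sum] at hR1
        linarith
    calc _ = ∑ s, P s * (∑ x, (blockAt (blockAt K (substring x s)) s * (R' s x - R x)).trace.re +
          ∑ x, (blockAt (blockAt K (substring x s)) s * blockAt (ρ' - ρ) x).trace.re) := by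
          refine Finset.sum_congr rfl fun s _ => ?_
          rw [← mul_sub, ← Finset.sum_add_distrib, ← Finset.sum_sub_distrib]
          congr 1
          refine Finset.sum_congr rfl fun x _ => ?_
          rw [blockAt_sub, Matrix.mul_sub, Matrix.mul_sub, trace_sub, trace_sub, Complex.sub_re,
            Complex.sub_re]
          ring
      _ ≤ ∑ s, P s * ((2 * Real.sqrt δ + if δ ≤ ∑ α ∈ (G s)ᶜ, ω α then 1 else 0) + τ) :=
          Finset.sum_le_sum fun s _ => mul_le_mul_of_nonneg_left (add_le_add (hA s) (hB s))
            (hP1.1 s)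
      _ = (2 * Real.sqrt δ + τ) * ∑ s, P s + ∑ s with δ ≤ ∑ α ∈ (G s)ᶜ, ω α, P s := by
          rw [Finset.mul_sum, Finset.sum_filter, ← Finset.sum_add_distrib]
          refine Finset.sum_congr rfl fun s _ => ?_
          split_ifs <;> ring
      _ ≤ 2 * Real.sqrt δ + ε + τ := by
          rw [hP1.2]
          linarith
  · have hσb0 : 0 ≤ ((m : ℝ) ^ n)⁻¹ • ∑ α, ς α := by
      have := smul_mono_right (inv_nonneg.2 hN.le)
        (Finset.sum_nonneg fun α (_ : α ∈ Finset.univ) => hς0 α)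
      rwa [smul_zero] at this
    have hσb1 : (((m : ℝ) ^ n)⁻¹ • ∑ α, ς α).trace.re ≤ 1 := by
      rw [trace_smul, Complex.real_smul, Complex.re_ofReal_mul, trace_sum, Complex.re_sum,
        inv_mul_le_iff₀ hN, mul_one, ← hcard]
      refine (Finset.sum_le_sum fun α _ => hς1 α).trans (le_of_eq ?_)
      simp
    have hne : Nonempty (Sample n r × E) := by
      have h1 : Nonempty (Sample n r) := by
        by_contra h
        rw [not_nonempty_iff] at h
        have := hP1.2
        simp at this
      have h2 : Nonempty E := by
        by_contra h
        rw [not_nonempty_iff] at h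
        have := hσ.2
        simp [Matrix.trace] at this
      infer_instance
    -- The side-information operator is the uniform mixture of the references, attached to the
    -- sample with weight `P s`. Its normalisation supplies the second factor `m ^ n`.
    obtain ⟨σ', hσ's, hσ'le⟩ := exists_isState_ge
      (σ := blockSum fun s : Sample n r => P s • (((m : ℝ) ^ n)⁻¹ • ∑ α, ς α))
      (blockSum_nonneg fun s => by
        have := smul_mono_right (hP1.1 s) hσb0
        rwa [smul_zero] at this)
      (by
        rw [trace_blockSum, Complex.re_sum, ← hP1.2]
        refine Finset.sum_le_sum fun s _ => ?_
        rw [trace_smul, Complex.real_smul, Complex.re_ofReal_mul]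
        exact mul_le_of_le_one_right (hP1.1 s) hσb1)
    refine ⟨σ', hσ's, le_iff.1 ?_⟩
    rw [one_kronecker_eq_blockSum, smul_blockSum]
    refine blockSum_mono fun z => ?_
    refine le_trans ?_ (smul_mono_right (by positivity) hσ'le)
    rw [smul_blockSum]
    refine blockSum_mono fun s => ?_
    rw [smul_comm]
    refine smul_mono_right (hP1.1 s) ?_
    rw [smul_smul, show ((m : ℝ) ^ n) ^ 2 * Θ * ((m : ℝ) ^ n)⁻¹ = (m : ℝ) ^ n * Θ by
      field_simp]
    by_cases hg : good s
    · simp only [R', if_pos hg]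
      refine marginal_le hq hR0 hT3 hς0 hςb s (G s) hΘ0.le ?_ z
      intro α hα
      refine hΘ s α ?_
      have h := (Finset.mem_filter.1 hα).2
      simp only [badRows, Set.mem_ofPred_eq, not_le, β, Equiv.symm_apply_apply, s.2] at h
      exact h
    · simp only [R', if_neg hg, Finset.sum_const_zero]
      have := smul_mono_right (show 0 ≤ (m : ℝ) ^ n * Θ by positivity)
        (Finset.sum_nonneg fun α (_ : α ∈ Finset.univ) => hς0 α)
      rwa [smul_zero] at this

end Core

/-! ### Bounds on the smooth min-entropy -/

section Entropy

variable {A B : Type*} [Fintype A] [DecidableEq A] [Fintype B] [DecidableEq B]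

theorem le_smoothMinEntropy {η : ℝ} {ρ F : Matrix (A × B) (A × B) ℂ} (hF : IsSubnormalizedState F)
    (hd : traceNorm (F - ρ) ≤ η) {σ : Matrix B B ℂ} (hσ : IsState σ) {t : ℝ} (ht : 0 < t)
    (hle : (t • ((1 : Matrix A A ℂ) ⊗ₖ σ) - F).PosSemidef) :
    ((-Real.logb 2 t : ℝ) : EReal) ≤ smoothMinEntropy η ρ :=
  le_iSup₂_of_le F ⟨hF, hd⟩ (le_iSup₂_of_le σ hσ
    (le_iSup₂ (f := fun (t : ℝ) (_ : 0 < t ∧ (t • ((1 : Matrix A A ℂ) ⊗ₖ σ) - F).PosSemidef) =>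
      ((-Real.logb 2 t : ℝ) : EReal)) t ⟨ht, hle⟩))

/-- The zero operator is an admissible smoothing, and it is dominated with arbitrarily small `t`. -/
theorem smoothMinEntropy_eq_top [Nonempty B] {η : ℝ} {ρ : Matrix (A × B) (A × B) ℂ}
    (hd : traceNorm (0 - ρ) ≤ η) : smoothMinEntropy η ρ = ⊤ := by
  rw [EReal.eq_top_iff_forall_lt]
  intro y
  obtain ⟨σ, hσ, -⟩ := exists_isState_ge (I := B) (σ := 0) le_rfl (by simp)
  have h := le_smoothMinEntropy (F := 0) (η := η) (ρ := ρ) ⟨PosSemidef.zero, by simp⟩ hd hσ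
    (t := 2 ^ (-(y + 1))) (by positivity) (by
      rw [sub_zero, one_kronecker_eq_blockSum, smul_blockSum, ← nonneg_iff_posSemidef]
      refine blockSum_nonneg fun _ => ?_
      have := smul_mono_right (show (0 : ℝ) ≤ 2 ^ (-(y + 1)) by positivity)
        (nonneg_iff_posSemidef.2 hσ.1)
      rwa [smul_zero] at this)
  rw [Real.logb_rpow (by norm_num) (by norm_num), neg_neg] at h
  exact lt_of_lt_of_le (by exact_mod_cast lt_add_one y) h

theorem smoothMinEntropy_mono {η η' : ℝ} (h : η ≤ η') (ρ : Matrix (A × B) (A × B) ℂ) :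
    smoothMinEntropy η ρ ≤ smoothMinEntropy η' ρ :=
  iSup₂_le fun F hF => le_iSup₂_of_le F ⟨hF.1, hF.2.trans h⟩ le_rfl

end Entropy

/-! ### Choice of the number of bins and exponent bounds -/

section Arithmetic

/-- By concavity, `log₂` lies above its chord on `[2, 4]`, which is `u / 2`. -/
theorem half_le_logb {u : ℝ} (h2 : 2 ≤ u) (h4 : u ≤ 4) : u / 2 ≤ Real.logb 2 u := by
  have hl : 0 < Real.log 2 := Real.log_pos (by norm_num)
  have h := strictConcaveOn_log_Ioi.concaveOn.2 (show (2 : ℝ) ∈ Set.Ioi 0 by norm_num)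
    (show (4 : ℝ) ∈ Set.Ioi 0 by norm_num) (show 0 ≤ 2 - u / 2 by linarith)
    (show 0 ≤ u / 2 - 1 by linarith) (by ring)
  have h4 : Real.log 4 = 2 * Real.log 2 := by
    rw [show (4 : ℝ) = 2 ^ 2 by norm_num, Real.log_pow]
    norm_num
  simp only [smul_eq_mul, h4] at h
  rw [show (2 - u / 2) * 2 + (u / 2 - 1) * 4 = u by ring] at h
  rw [Real.logb, le_div_iff₀ hl]
  linarith

theorem exists_bin_count {κ : ℝ} (h0 : 0 < κ) (h1 : κ ≤ 0.15) :
    ∃ m : ℕ, 0 < m ∧ 1 / (m : ℝ) + 2 * κ * Real.logb 2 m ≤ 2 * κ * Real.logb 2 (1 / κ) := by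
  have hy : 1 ≤ 1 / (2 * κ) := by
    rw [le_div_iff₀ (by positivity)]
    norm_num at h1
    linarith
  have hm1 : 1 ≤ ⌊1 / (2 * κ)⌋₊ := Nat.le_floor (by exact_mod_cast hy)
  have hle : (⌊1 / (2 * κ)⌋₊ : ℝ) ≤ 1 / (2 * κ) := Nat.floor_le (by positivity)
  have hlt : 1 / (2 * κ) < ⌊1 / (2 * κ)⌋₊ + 1 := Nat.lt_floor_add_one _
  generalize ⌊1 / (2 * κ)⌋₊ = m at hm1 hle hlt
  have hm : (1 : ℝ) ≤ m := by exact_mod_cast hm1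
  have hm0 : (0 : ℝ) < m := by linarith
  refine ⟨m, hm1, ?_⟩
  rw [le_div_iff₀ (by positivity)] at hle
  rw [div_lt_iff₀ (by positivity)] at hlt
  have hκm : 0 < κ * m := by positivity
  -- For `m = ⌊1/(2κ)⌋ ≥ 1`, the bounds `2κm ≤ 1 < 2κ(m + 1) ≤ 4κm` put `u = 1/(κm)` in `[2, 4]`;
  -- then `1/m = 2κ * (u/2) ≤ 2κ log u`.
  have hu := half_le_logb (u := 1 / (κ * m)) (by rw [le_div_iff₀ hκm]; linarith)
    (by rw [div_le_iff₀ hκm]; nlinarith)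
  have hsplit : Real.logb 2 (1 / κ) = Real.logb 2 m + Real.logb 2 (1 / (κ * m)) := by
    rw [← Real.logb_mul hm0.ne' (by positivity)]
    congr 1
    field_simp
  rw [hsplit]
  have h3 := mul_le_mul_of_nonneg_left hu (show 0 ≤ 2 * κ by positivity)
  have h4 : 2 * κ * (1 / (κ * m) / 2) = 1 / m := by field_simp
  rw [h4] at h3
  linarith

/-- The number `g` is the full entropy rate minus the profile average and the bin width `1/m`. The
sampler condition controls the damping factor, leaving an exponent `-r L g` to be gained from the
minimum. -/
theorem profile_weight_le {n r m : ℕ} (hr : 0 < r) (hm : 0 < m) {L t ξ : ℝ} (hL : 0 < L)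
    (ht : 0 < t) (s : Sample n r) (α : Fin n → Fin m)
    (h : (1 / (n : ℝ)) * ∑ i, ((α i : ℕ) : ℝ) / m - ξ <
      (1 / (r : ℝ)) * ∑ i ∈ s.1, ((α i : ℕ) : ℝ) / m) :
    (∏ i ∈ s.1, (((2 : ℝ) ^ (L / m)) ^ (α i : ℕ))⁻¹) *
        min 1 (t * ∏ i, ((2 : ℝ) ^ (L / m)) ^ ((α i : ℕ) + 1)) ≤
      2 ^ (-(r * L * (-Real.logb 2 t / (n * L) - 1 / m - ξ))) := by
  have hrn : r ≤ n := by
    have := Finset.card_le_univ s.1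
    rwa [s.2, Fintype.card_fin] at this
  have hr' : (0 : ℝ) < r := by exact_mod_cast hr
  have hrn' : (r : ℝ) ≤ n := by exact_mod_cast hrn
  have hn' : (0 : ℝ) < n := by linarith
  have hm' : (0 : ℝ) < m := by exact_mod_cast hm
  rw [← Finset.sum_div, ← Finset.sum_div] at h
  set Q : ℝ := ∑ i, ((α i : ℕ) : ℝ) with hQ
  set S : ℝ := ∑ i ∈ s.1, ((α i : ℕ) : ℝ) with hS
  have hp1 : ∏ i ∈ s.1, (((2 : ℝ) ^ (L / m)) ^ (α i : ℕ))⁻¹ = 2 ^ (-(L / m * S)) := by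
    rw [hS, Finset.mul_sum, ← Finset.sum_neg_distrib, Real.rpow_sum_of_pos (by norm_num)]
    refine Finset.prod_congr rfl fun i _ => ?_
    rw [← Real.rpow_natCast, ← Real.rpow_mul (by norm_num), ← Real.rpow_neg (by norm_num)]
  have hp2 : t * ∏ i, ((2 : ℝ) ^ (L / m)) ^ ((α i : ℕ) + 1) =
      2 ^ (Real.logb 2 t + L / m * (Q + n)) := by
    rw [Real.rpow_add (by norm_num), Real.rpow_logb (by norm_num) (by norm_num) ht]
    congr 1
    have : Q + n = ∑ i, (((α i : ℕ) : ℝ) + 1) := by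
      rw [Finset.sum_add_distrib]
      simp [hQ]
    rw [this, Finset.mul_sum, Real.rpow_sum_of_pos (by norm_num)]
    refine Finset.prod_congr rfl fun i _ => ?_
    rw [← Real.rpow_natCast, ← Real.rpow_mul (by norm_num)]
    push_cast
    rfl
  rw [hp1, hp2]
  set H : ℝ := Real.logb 2 t
  set g : ℝ := -H / (n * L) - Q / (n * m) - 1 / m with hg
  have hS' : r * (Q / (n * m)) - r * ξ ≤ S / m := by
    have h' := mul_le_mul_of_nonneg_left h.le hr'.le
    have e1 : r * (1 / r * (S / m)) = S / m := by field_simp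
    have e2 : r * (1 / n * (Q / m) - ξ) = r * (Q / (n * m)) - r * ξ := by field_simp
    rwa [e1, e2] at h'
  have ha : H + L / m * (Q + n) = -(n * L * g) := by
    rw [hg]
    field_simp
    ring
  have hb : -(r * L * (-H / (n * L) - 1 / m - ξ)) =
      -(L * (r * (Q / (n * m)) - r * ξ)) - r * L * g := by
    rw [hg]
    ring
  have hc : -(L / m * S) ≤ -(L * (r * (Q / (n * m)) - r * ξ)) := by
    have := mul_le_mul_of_nonneg_left hS' hL.le
    rw [show L / m * S = L * (S / m) by ring]
    linarith
  rw [ha, hb]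
  have hpos : (0 : ℝ) < 2 ^ (-(L / m * S)) := by positivity
  -- If `g ≤ 0`, the profile is already rich enough and the bound `1` suffices. Otherwise the
  -- operator bound gives `-n L g`, which is at most `-r L g` as `r ≤ n`.
  rcases le_total g 0 with h0 | h0
  · refine (mul_le_of_le_one_right hpos.le (min_le_left _ _)).trans ?_
    refine Real.rpow_le_rpow_of_exponent_le (by norm_num) ?_
    have : r * L * g ≤ 0 := mul_nonpos_of_nonneg_of_nonpos (by positivity) h0
    linarith
  · refine (mul_le_mul_of_nonneg_left (min_le_right _ _) hpos.le).trans ?_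
    rw [← Real.rpow_add (by norm_num)]
    refine Real.rpow_le_rpow_of_exponent_le (by norm_num) ?_
    have : r * L * g ≤ n * L * g := by gcongr
    linarith

end Arithmetic

/-! ### From operator bounds to entropy, and the conclusion -/

section Sampling

variable {X E : Type*} [Fintype X] [DecidableEq X] [Fintype E] [DecidableEq E]

theorem le_smoothMinEntropy_of_posDef {n r m : ℕ} (hr : 0 < r) (hm : 0 < m)
    (hX : 1 < Fintype.card X)
    {ρ ρ' : Matrix ((Fin n → X) × E) ((Fin n → X) × E) ℂ} (hρ : IsState ρ)
    (hρ' : IsSubnormalizedState ρ') {τ : ℝ} (hτ : traceNorm (ρ' - ρ) ≤ τ)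
    {σ : Matrix E E ℂ} (hσ : IsState σ) (hσ' : σ.PosDef) {t : ℝ} (ht : 0 < t)
    (hle : (t • ((1 : Matrix (Fin n → X) (Fin n → X) ℂ) ⊗ₖ σ) - ρ').PosSemidef)
    {ξ δ ε : ℝ} {P : Sample n r → ℝ} (hP : IsParallelSampler ξ δ ε P) :
    ((r * Real.logb 2 (Fintype.card X) *
        (-Real.logb 2 t / (n * Real.logb 2 (Fintype.card X)) - 1 / m - ξ) -
        2 * n * Real.logb 2 m : ℝ) : EReal) ≤
      smoothMinEntropy (2 * Real.sqrt δ + ε + τ) (sampledState P ρ) := by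
  set L := Real.logb 2 (Fintype.card X) with hLdef
  have hX' : (1 : ℝ) < Fintype.card X := by exact_mod_cast hX
  have hL : 0 < L := Real.logb_pos (by norm_num) hX'
  have hm' : (0 : ℝ) < m := by exact_mod_cast hm
  have hqm : ((2 : ℝ) ^ (L / m)) ^ m = Fintype.card X := by
    rw [← Real.rpow_natCast, ← Real.rpow_mul (by norm_num), div_mul_cancel₀ _ hm'.ne', hLdef,
      Real.rpow_logb (by norm_num) (by norm_num) (by linarith)]
  obtain ⟨F, hF, hFd, σ', hσ's, hF'⟩ := exists_smoothed_sampledState hm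
    (q := (2 : ℝ) ^ (L / m)) (by positivity) hqm hρ hρ' hτ hσ hσ' ht hle hP
    (Θ := 2 ^ (-(r * L * (-Real.logb 2 t / (n * L) - 1 / m - ξ)))) (by positivity)
    (fun s α h => profile_weight_le hr hm hL ht s α h)
  refine le_trans (le_of_eq ?_) (le_smoothMinEntropy hF hFd hσ's (by positivity) hF')
  rw [Real.logb_mul (by positivity) (by positivity), Real.logb_rpow (by norm_num) (by norm_num),
    Real.logb_pow, Real.logb_pow]
  congr 1
  push_cast
  ring

-- The splitting needs an invertible `σ`. Replacing it by `(σ + u • 1) / (1 + u d)`, with `d = |E|`,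
-- and `t` by `t (1 + u d)` keeps the domination; the bound is continuous as `u → 0⁺`.
open Filter Topology in
theorem le_smoothMinEntropy_sampledState {n r m : ℕ} (hr : 0 < r) (hm : 0 < m)
    (hX : 1 < Fintype.card X)
    {ρ ρ' : Matrix ((Fin n → X) × E) ((Fin n → X) × E) ℂ} (hρ : IsState ρ)
    (hρ' : IsSubnormalizedState ρ') {τ : ℝ} (hτ : traceNorm (ρ' - ρ) ≤ τ)
    {σ : Matrix E E ℂ} (hσ : IsState σ) {t : ℝ} (ht : 0 < t)
    (hle : (t • ((1 : Matrix (Fin n → X) (Fin n → X) ℂ) ⊗ₖ σ) - ρ').PosSemidef)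
    {ξ δ ε : ℝ} {P : Sample n r → ℝ} (hP : IsParallelSampler ξ δ ε P) :
    ((r * Real.logb 2 (Fintype.card X) *
        (-Real.logb 2 t / (n * Real.logb 2 (Fintype.card X)) - 1 / m - ξ) -
        2 * n * Real.logb 2 m : ℝ) : EReal) ≤
      smoothMinEntropy (2 * Real.sqrt δ + ε + τ) (sampledState P ρ) := by
  set L := Real.logb 2 (Fintype.card X)
  let d : ℝ := Fintype.card E
  have hd : 0 ≤ d := Nat.cast_nonneg _
  let f : ℝ → ℝ := fun u => r * L * (-Real.logb 2 (t * (1 + u * d)) / (n * L) - 1 / m - ξ) -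
    2 * n * Real.logb 2 m
  have hf : ContinuousAt f 0 := by
    have h1 : ContinuousAt (fun u : ℝ => Real.logb 2 (t * (1 + u * d))) 0 := by
      unfold Real.logb
      refine (ContinuousAt.log (by fun_prop) ?_).div_const _
      simpa using ht.ne'
    fun_prop
  have hf0 : f 0 = r * L * (-Real.logb 2 t / (n * L) - 1 / m - ξ) - 2 * n * Real.logb 2 m := by
    simp [f]
  rw [← hf0]
  have htend : Tendsto (fun u => ((f u : ℝ) : EReal)) (𝓝[>] 0) (𝓝 ((f 0 : ℝ) : EReal)) :=
    (continuous_coe_real_ereal.tendsto _).comp (hf.tendsto.mono_left nhdsWithin_le_nhds)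
  refine le_of_tendsto htend ?_
  filter_upwards [self_mem_nhdsWithin] with u hu
  have hu0 : (0 : ℝ) < u := hu
  have hc : 0 < 1 + u * d := by positivity
  have hpd : (σ + u • (1 : Matrix E E ℂ)).PosDef :=
    PosDef.posSemidef_add hσ.1 (PosDef.one.smul hu0)
  refine le_smoothMinEntropy_of_posDef hr hm hX hρ hρ' hτ
    (σ := (1 + u * d)⁻¹ • (σ + u • (1 : Matrix E E ℂ))) ⟨?_, ?_⟩ ?_ (t := t * (1 + u * d))
    (by positivity) ?_ hP
  · exact (hpd.smul (inv_pos.2 hc)).posSemidef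
  · rw [trace_smul, trace_add, trace_smul, trace_one, hσ.2]
    simp only [Complex.real_smul]
    have : ((1 + u * d : ℝ) : ℂ) ≠ 0 := by exact_mod_cast hc.ne'
    rw [Complex.ofReal_inv, inv_mul_eq_one₀ this]
    simp [d]
  · exact hpd.smul (inv_pos.2 hc)
  · rw [← le_iff, one_kronecker_eq_blockSum, smul_blockSum] at hle ⊢
    refine hle.trans (blockSum_mono fun _ => ?_)
    rw [smul_smul, mul_assoc, mul_inv_cancel₀ hc.ne', mul_one]
    refine smul_mono_right ht.le (le_add_of_nonneg_right ?_)
    exact nonneg_iff_posSemidef.2 (PosDef.one.smul hu0).posSemidef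

end Sampling

end EntropySampling

theorem theorem5p13 {X E : Type*} [Fintype X] [DecidableEq X] [Fintype E] [DecidableEq E]
    {n r : ℕ} (hr : 0 < r) (hX : 1 < Fintype.card X)
    (ρ : Matrix ((Fin n → X) × E) ((Fin n → X) × E) ℂ)
    (hρ : EntropySampling.IsState ρ) (hcl : EntropySampling.IsClassicalOn ρ)
    (ξ δ ε : ℝ) (hξ : ξ ∈ Set.Icc (0 : ℝ) 1) (hδ : 0 ≤ δ)
    (P : EntropySampling.Sample n r → ℝ) (hP : EntropySampling.IsParallelSampler ξ δ ε P)
    (κ : ℝ) (hκ : κ = (n : ℝ) / ((r : ℝ) * Real.logb 2 (Fintype.card X))) (hκ' : κ ≤ 0.15)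
    (θ τ : ℝ) (hθ : 0 < θ) (hτ : 0 ≤ τ) :
    EntropySampling.smoothMinEntropyRate τ ρ
        - ((ξ + 2 * Real.logb 2 (1 / θ) / ((n : ℝ) * Real.logb 2 (Fintype.card X))
            + 2 * κ * Real.logb 2 (1 / κ) : ℝ) : EReal)
      ≤ EntropySampling.smoothMinEntropyRate (2 * Real.sqrt δ + ε + 2 * θ + τ)
          (EntropySampling.sampledState P ρ) := by
  have hP1 := (hP 0).1
  have hS : Nonempty (EntropySampling.Sample n r) := by
    by_contra h
    rw [not_nonempty_iff] at h
    have := hP1.2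
    simp at this
  obtain ⟨s₀⟩ := id hS
  have hrn : r ≤ n := by
    have := Finset.card_le_univ s₀.1
    rwa [s₀.2, Fintype.card_fin] at this
  have hE : Nonempty E := by
    by_contra h
    rw [not_nonempty_iff] at h
    have := hρ.2
    simp [Matrix.trace] at this
  have hε : 0 ≤ ε := by
    -- A single row already shows `ε ≥ 0`, because the probability it bounds is nonnegative.
    have h := (hP 1).2 (fun _ => 1) ⟨fun _ => by norm_num, by simp⟩ (fun _ _ => 0) (by simp)
    exact (Finset.sum_nonneg fun s _ => hP1.1 s).trans h
  have hX' : (1 : ℝ) < Fintype.card X := by exact_mod_cast hX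
  have hL : 0 < Real.logb 2 (Fintype.card X) := Real.logb_pos (by norm_num) hX'
  have hr' : (0 : ℝ) < r := by exact_mod_cast hr
  have hn' : (0 : ℝ) < n := by exact_mod_cast hr.trans_le hrn
  have hrate : ∀ k : ℕ, Real.logb 2 (Fintype.card (Fin k → X)) =
      k * Real.logb 2 (Fintype.card X) := by
    intro k
    rw [Fintype.card_fun, Fintype.card_fin, Nat.cast_pow, Real.logb_pow]
  have hsq := Real.sqrt_nonneg δ
  rw [EntropySampling.smoothMinEntropyRate, EntropySampling.smoothMinEntropyRate, hrate, hrate]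
  set L := Real.logb 2 (Fintype.card X)
  have hrL : (0 : EReal) < ((r * L : ℝ) : EReal) := by exact_mod_cast mul_pos hr' hL
  have hnL : (0 : EReal) < ((n * L : ℝ) : EReal) := by exact_mod_cast mul_pos hn' hL
  -- For `θ > 1` the term `log(1/θ)` is negative, but the smoothing radius exceeds `1`, the
  -- trace-norm bound for reaching the zero operator, so the right side is `+∞`.
  rcases lt_or_ge 1 θ with hθ1 | hθ1
  · rw [EntropySampling.smoothMinEntropy_eq_top (η := 2 * Real.sqrt δ + ε + 2 * θ + τ)
      ((EntropySampling.traceNorm_zero_sub_sampledState_le hP1 hρ).trans (by linarith)),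
      EReal.top_div_of_pos_ne_top hrL (EReal.coe_ne_top _)]
    exact le_top
  have hlog : 0 ≤ Real.logb 2 (1 / θ) := Real.logb_nonneg (by norm_num) (by
    rw [le_div_iff₀ hθ]; linarith)
  have hκ0 : 0 < κ := by rw [hκ]; positivity
  obtain ⟨m, hm, hm'⟩ := EntropySampling.exists_bin_count hκ0 hκ'
  set Δ := ξ + 2 * Real.logb 2 (1 / θ) / (n * L) + 2 * κ * Real.logb 2 (1 / κ) with hΔ
  rw [EReal.sub_le_iff_le_add (.inl (EReal.coe_ne_bot _)) (.inl (EReal.coe_ne_top _)),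
    EReal.div_le_iff_le_mul hnL (EReal.coe_ne_top _)]
  refine iSup₂_le fun ρ' hρ' => iSup₂_le fun σ hσ => iSup₂_le fun t ht => ?_
  rw [← EReal.div_le_iff_le_mul hnL (EReal.coe_ne_top _),
    ← EReal.sub_le_iff_le_add (.inl (EReal.coe_ne_bot _)) (.inl (EReal.coe_ne_top _)),
    EReal.le_div_iff_mul_le hrL (EReal.coe_ne_top _)]
  refine le_trans ?_ ((EntropySampling.le_smoothMinEntropy_sampledState hr hm hX hρ hρ'.1 hρ'.2 hσ
    ht.1 ht.2 hP).trans (EntropySampling.smoothMinEntropy_mono (by linarith) _))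
  rw [← EReal.coe_div, ← EReal.coe_sub, ← EReal.coe_mul, EReal.coe_le_coe_iff]
  -- By the definition of `κ`, the cost `m^(2n)` of recombining the profiles is a rate loss of `2κ
  -- log m`.
  have hb : 2 * n * Real.logb 2 m = r * L * (2 * κ * Real.logb 2 m) := by
    rw [hκ]
    field_simp
  have hc : 0 ≤ 2 * Real.logb 2 (1 / θ) / (n * L) := by positivity
  rw [hb, ← mul_sub, mul_comm]
  refine mul_le_mul_of_nonneg_left ?_ (by positivity)
  rw [hΔ]
  linarith
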